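/- Let $\mathcal X$ be a measurable space with countably generated $\sigma$-algebra, $\mathrm dx$ a non-zero base measure on $\mathcal X$, $N,K\ge 0$ integers, and $U^0,\dots,U^N:\mathcal X\to\mathbb R$ measurable potentials with $Z_n=\int e^{-U^n(x)}\,\mathrm dx<\infty$. Let $\pi^n(\mathrm dx)=Z_n^{-1}e^{-U^n(x)}\,\mathrm dx$ and $\boldsymbol\pi=\pi^0\otimes\cdots\otimes\pi^N$. For $0\le n\le N$ let $K^n$ be a $\pi^n$-invariant Markov kernel on $\mathcal X$, with $K^0(x,\cdot)=\pi^0$ for all $x$. For $1\le n\le N$ and $1\le k\le K$ let $P^{n-1}_k$ and $Q^n_{k-1}$ be Markov kernels on $\mathcal X$, and define on $\mathcal X^{K+1}$ $$\mathbb P^{n-1}_K(\mathrm dx_{0:K})=\pi^{n-1}(\mathrm dx_0)\prod_{k=1}^K P^{n-1}_k(x_{k-1},\mathrm dx_k),\qquad \mathbb Q^{n}_K(\mathrm dx_{0:K})=\pi^{n}(\mathrm dx_K)\prod_{k=1}^K Q^{n}_{k-1}(x_{k},\mathrm dx_{k-1}).$$ Assume that $\mathbb P^{n-1}_K$ and $\mathbb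 Q^n_K$ are mutually absolutely continuous for every $n$, and put $$W^n_K=\log Z_{n-1}-\log Z_n-\log\frac{\mathrm d\mathbb Q^n_K}{\mathrm d\mathbb P^{n-1}_K},\qquad \alpha^n_K(x_{0:K},x'_{0:K})=\exp\bigl(\min\{0,W^n_K(x'_{0:K})-W^n_K(x_{0:K})\}\bigr).$$ The accelerated parallel tempering chain $\mathbf X_t=(X^0_t,\dots,X^N_t)$ is the (time-inhomogeneous) Markov chain on $\mathcal X^{N+1}$ whose iteration $t\ge1$, started from $\mathbf X_{t-1}$, is as follows. (1) Local exploration: independently for all $n$, replace $X^n$ by a sample from $K^n(X^n,\cdot)$. (2) Communication: for each $n\in\{1,\dots,N\}$ with $n\equiv t \pmod 2$, perform the $n$-th accelerated swap: given the current state, draw independently a forward path $\overrightarrow X_{0:K}$ with $\overrightarrow X_0=X^{n-1}$, $\overrightarrow X_k\sim P^{n-1}_k(\overrightarrow X_{k-1},\cdot)$, and a backward path $\overleftarrow X_{0:K}$ with $\overleftarrow X_K=X^n$, $\overleftarrow X_{k-1}\sim Q^n_{k-1}(\overleftarrow X_k,\cdot)$; with probability $\alpha^n_K(\overrightarrow X_{0:K},\overleftarrow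 X_{0:K})$ accept and replace $(X^{n-1},X^n)$ by $(\overleftarrow X_0,\overrightarrow X_K)$; otherwise reject and leave the state unchanged. The result is $\mathbf X_t$. Then: 1. The chain is ergodic: for $\boldsymbol\pi$-almost every initial state $\mathbf X_0=\mathbf x$, the law of $\mathbf X_t$ converges to $\boldsymbol\pi$ in total variation as $t\to\infty$. 2. The chain is $\boldsymbol\pi$-invariant: for every $t\ge1$, if $\mathbf X_{t-1}\sim\boldsymbol\pi$ then $\mathbf X_t\sim\boldsymbol\pi$. 3. For every $t\ge1$ and every $n\in\{1,\dots,N\}$ with $n\equiv t\pmod 2$, if $\mathbf X_{t-1}\sim\boldsymbol\pi$, then the probability that the $n$-th accelerated swap of iteration $t$ is rejected equals $$\bigl\|\mathbb P^{n-1}_K\otimes\mathbb Q^n_K-\mathbb Q^n_K\otimes\mathbb P^{n-1}_K\bigr\|_{\mathrm{TV}},$$ where $\|\mu-\nu\|_{\mathrm{TV}}=\sup_h|\int h\,\mathrm d\mu-\int h\,\mathrm d\nu|$ over measurable $h$ with values in $[0,1]$. -/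

import Mathlib

open MeasureTheory ProbabilityTheory

noncomputable section

/-- Total variation distance `sup_h |∫ h dμ - ∫ h dν|`, over measurable `h` with values in
`[0, 1]`. -/
def tvDist {Ω : Type*} [MeasurableSpace Ω] (μ ν : Measure Ω) : ℝ :=
  ⨆ h : {h : Ω → ℝ // Measurable h ∧ ∀ ω, h ω ∈ Set.Icc (0 : ℝ) 1},
    |∫ ω, h.1 ω ∂μ - ∫ ω, h.1 ω ∂ν|

/-- The law of the path `(x_0, …, x_K)` of the time-inhomogeneous Markov chain that starts at
`x_0 = x` and moves from `x_k` to `x_{k+1}` with the kernel `R k`. -/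
def pathKernel {X : Type*} [MeasurableSpace X] :
    (K : ℕ) → (Fin K → Kernel X X) → Kernel X (Fin (K + 1) → X)
  | 0, _ => Kernel.id.map (fun x _ => x)
  | K + 1, R =>
      (pathKernel K (fun k => R k.castSucc) ⊗ₖ
          Kernel.prodMkLeft X ((R (Fin.last K)).comap (fun p : Fin (K + 1) → X => p (Fin.last K))
            (measurable_pi_apply _))).map
        (fun q => (Fin.snoc q.1 q.2 : Fin (K + 2) → X))

/-- Measurability of the product of Markov kernels. -/
theorem measurable_pi_kernel {X : Type*} [MeasurableSpace X] {ι : Type*} [Fintype ι]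
    (κ : ι → Kernel X X) [∀ i, IsMarkovKernel (κ i)] :
    Measurable fun x : ι → X => Measure.pi fun i => κ i (x i) := by
  refine Measurable.measure_of_isPiSystem_of_isProbabilityMeasure
    (generateFrom_pi (α := fun _ : ι => X)).symm
    isPiSystem_pi ?_
  rintro s ⟨t, ht, rfl⟩
  simp only [Measure.pi_pi]
  refine Finset.measurable_fun_prod _ fun i _ => ?_
  exact ((κ i).measurable_coe (ht i (Set.mem_univ i))).comp (measurable_pi_apply i)

/-- The ingredients of accelerated parallel tempering with `N + 1` chains on the state space `X`
and `K` acceleration steps: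
* a base measure and the potentials `U^0, …, U^N`;
* the local exploration kernels `K^0, …, K^N`;
* `P i k` is the forward accelerator `P^{n-1}_{k+1}` (from `x_k` to `x_{k+1}`) and `Q i k` is the
  backward accelerator `Q^n_k` (from `x_{k+1}` to `x_k`) of the swap number `n = i + 1`. -/
structure APT (X : Type*) [MeasurableSpace X] (N K : ℕ) where
  base : Measure X
  U : Fin (N + 1) → X → ℝ
  explore : Fin (N + 1) → Kernel X X
  P : Fin N → Fin K → Kernel X X
  Q : Fin N → Fin K → Kernel X X
  markov_explore : ∀ n, IsMarkovKernel (explore n)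
  markov_P : ∀ i k, IsMarkovKernel (P i k)
  markov_Q : ∀ i k, IsMarkovKernel (Q i k)

namespace APT

attribute [instance] APT.markov_explore APT.markov_P APT.markov_Q

variable {X : Type*} [MeasurableSpace X] {N K : ℕ} (A : APT X N K)

/-- The normalising constant `Z_n = ∫ exp (-U^n(x)) dx`. -/
def Z (n : Fin (N + 1)) : ℝ := ∫ x, Real.exp (-A.U n x) ∂A.base

/-- The annealing distribution `π^n`, with density `exp (-U^n) / Z_n` w.r.t. the base measure. -/
def annealed (n : Fin (N + 1)) : Measure X := A.base.tilted fun x => -A.U n x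

/-- The joint distribution `π^0 ⊗ ⋯ ⊗ π^N`. -/
def target : Measure (Fin (N + 1) → X) := Measure.pi A.annealed

/-- Forward path `x_{0:K}` of the swap `n = i + 1`, given its start `x_0`. -/
def fwdPath (i : Fin N) : Kernel X (Fin (K + 1) → X) := pathKernel K (A.P i)

/-- Backward path `x_{0:K}` of the swap `n = i + 1`, given its start `x_K`: the chain that uses
successively `Q^n_{K-1}, …, Q^n_0`, read in reversed order. -/
def bwdPath (i : Fin N) : Kernel X (Fin (K + 1) → X) :=
  (pathKernel K fun k => A.Q i k.rev).map fun p k => p k.rev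

/-- The forward path law `ℙ^{n-1}_K`, `n = i + 1`. -/
def fwdLaw (i : Fin N) : Measure (Fin (K + 1) → X) := (A.annealed i.castSucc).bind (A.fwdPath i)

/-- The backward path law `ℚ^n_K`, `n = i + 1`. -/
def bwdLaw (i : Fin N) : Measure (Fin (K + 1) → X) := (A.annealed i.succ).bind (A.bwdPath i)

/-- The work `W^n_K = ΔF_n - log (dℚ^n_K / dℙ^{n-1}_K)`, where `ΔF_n = log Z_{n-1} - log Z_n` and
`n = i + 1`. -/
def work (i : Fin N) (p : Fin (K + 1) → X) : ℝ :=
  (Real.log (A.Z i.castSucc) - Real.log (A.Z i.succ)) -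
    Real.log ((A.bwdLaw i).rnDeriv (A.fwdLaw i) p).toReal

/-- Acceptance probability `α^n_K` of the swap `n = i + 1`, for the forward path `p` and the
backward path `q`. -/
def acceptProb (i : Fin N) (p q : Fin (K + 1) → X) : ℝ :=
  Real.exp (min 0 (A.work i q - A.work i p))

/-- Outcome of the swap `n = i + 1` for the state `x`, forward path `p`, backward path `q` and
uniform variable `u`: the new state, and whether the swap was accepted. -/
def swapUpdate (i : Fin N)
    (z : (Fin (N + 1) → X) × ((Fin (K + 1) → X) × (Fin (K + 1) → X)) × unitInterval) :
    (Fin (N + 1) → X) × Bool :=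
  if (z.2.2 : ℝ) < A.acceptProb i z.2.1.1 z.2.1.2 then
    (Function.update (Function.update z.1 i.castSucc (z.2.1.2 0)) i.succ
      (z.2.1.1 (Fin.last K)), true)
  else (z.1, false)

theorem measurable_swapUpdate (i : Fin N) : Measurable (A.swapUpdate i) := by
  have hw : Measurable (A.work i) := by
    unfold work
    exact measurable_const.sub (Measure.measurable_rnDeriv _ _).ennreal_toReal.log
  have ha : Measurable fun z : (Fin (N + 1) → X) ×
      ((Fin (K + 1) → X) × (Fin (K + 1) → X)) × unitInterval =>
      A.acceptProb i z.2.1.1 z.2.1.2 := by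
    unfold acceptProb
    fun_prop
  unfold swapUpdate
  refine Measurable.ite (measurableSet_lt (by fun_prop) ha) ?_ (by fun_prop)
  refine Measurable.prodMk ?_ measurable_const
  refine measurable_pi_iff.2 fun j => ?_
  simp only [Function.update_apply]
  split_ifs <;> fun_prop

/-- The accelerated swap move number `n = i + 1`, together with the information whether it was
accepted (`true`) or rejected (`false`). The forward path starts at `x^{n-1}`, the backward path
at `x^n`; the two paths and the uniform variable are independent given the state. -/
def swapWithFlag (i : Fin N) : Kernel (Fin (N + 1) → X) ((Fin (N + 1) → X) × Bool) :=
  (Kernel.id ×ₖ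
    (((A.fwdPath i).comap (fun x : Fin (N + 1) → X => x i.castSucc) (measurable_pi_apply _) ×ₖ
        (A.bwdPath i).comap (fun x : Fin (N + 1) → X => x i.succ) (measurable_pi_apply _)) ×ₖ
      Kernel.const _ (volume : Measure unitInterval))).map (A.swapUpdate i)

/-- The accelerated swap move number `n = i + 1`. -/
def swap (i : Fin N) : Kernel (Fin (N + 1) → X) (Fin (N + 1) → X) := (A.swapWithFlag i).fst

/-- The local exploration move: `x^n ~ K^n(x^n, ·)`, independently for `n = 0, …, N`. -/
def exploration : Kernel (Fin (N + 1) → X) (Fin (N + 1) → X) where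
  toFun x := Measure.pi fun n => A.explore n (x n)
  measurable' := measurable_pi_kernel A.explore

/-- The part of iteration `t` that consists of the local exploration move and of the accelerated
swap moves number `n ≤ m` with `n ≡ t mod 2`, in increasing order. -/
def stepUpTo (t : ℕ) : ℕ → Kernel (Fin (N + 1) → X) (Fin (N + 1) → X)
  | 0 => A.exploration
  | m + 1 =>
      if h : m < N ∧ m + 1 ≡ t [MOD 2] then A.swap ⟨m, h.1⟩ ∘ₖ stepUpTo t m
      else stepUpTo t m

/-- The transition kernel from `X_{t-1}` to `X_t`. -/
def step (t : ℕ) : Kernel (Fin (N + 1) → X) (Fin (N + 1) → X) := A.stepUpTo t N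

/-- The law of `X_t` given `X_0`. -/
def lawAt : ℕ → Kernel (Fin (N + 1) → X) (Fin (N + 1) → X)
  | 0 => Kernel.id
  | t + 1 => A.step (t + 1) ∘ₖ lawAt t

/-- The probability that the swap number `n = i + 1` is rejected in iteration `t`, when
`X_{t-1} ~ π^0 ⊗ ⋯ ⊗ π^N`. -/
def rejectionProb (t : ℕ) (i : Fin N) : ℝ :=
  ((A.target.bind (A.stepUpTo t i)).bind (A.swapWithFlag i)).real {z | z.2 = false}

end APT

end

/-! Write `L` for the density of the backward path law ℚ with respect to the forward path law ℙ. The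
free energy difference cancels in the acceptance rule, so α(p, q) = min(1, L(p)/L(q)), and against ℙ
⊗ ℙ the pair of proposed paths, accepted, has density α(p, q) L(q) = min(L(p), L(q)). This symmetry
is detailed balance on path space (`lintegral_acceptProb_swap`). Under the target, the two paths can
be drawn first and their starting points inserted into the state. Acceptance exchanges the roles of
the paths, so the swap preserves the target. The rejected mass is the integral of L(q) - min(L(p),
L(q)) = (L(q) - L(p))⁺, which is the total variation distance between ℙ ⊗ ℚ and ℚ ⊗ ℙ
(`tvDist_withDensity`).

For ergodicity, follow the event that every swap is accepted, which has positive probability.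
Coordinate 0 is refreshed from π^0 in each iteration. The alternating swaps carry refreshed
coordinates up to N and back, and mutual absolute continuity of the path laws turns a refreshed
π^{n-1} into a law dominating π^n, and conversely. After 2(N + 1) iterations the law from every
initial state dominates the target (`target_absolutelyContinuous_lawAt`).

Since the swap schedule has period 2, blocks of 2(N + 1) iterations form a homogeneous chain with
kernel T. Let g(x, y) be the decreasing limit of the distances between its laws from x and y. It is
subharmonic for T ⊗ T, hence almost surely a constant c. The first-step laws share mass, leaving
remainders of mass ε < 1, and this forces ε c ≤ ε² c, so c = 0 (`ae_tendsto_tvDist_of_invariant`).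
Monotonicity extends convergence from block times to all times. -/

noncomputable section

/-! ### Total variation distance and Markov kernels. -/

section TotalVariation

variable {Ω : Type*} [MeasurableSpace Ω]

theorem integrable_of_mem_Icc {μ : Measure Ω} [IsFiniteMeasure μ] {h : Ω → ℝ}
    (hm : Measurable h) (hI : ∀ ω, h ω ∈ Set.Icc (0 : ℝ) 1) : Integrable h μ :=
  Integrable.of_bound hm.aestronglyMeasurable 1 (ae_of_all _ fun ω => by
    rw [Real.norm_eq_abs, abs_of_nonneg (hI ω).1]; exact (hI ω).2)

theorem integral_mem_Icc {μ : Measure Ω} [IsFiniteMeasure μ] {h : Ω → ℝ}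
    (hm : Measurable h) (hI : ∀ ω, h ω ∈ Set.Icc (0 : ℝ) 1) :
    ∫ ω, h ω ∂μ ∈ Set.Icc 0 (μ.real Set.univ) := by
  refine ⟨integral_nonneg fun ω => (hI ω).1, ?_⟩
  calc ∫ ω, h ω ∂μ ≤ ∫ _, (1 : ℝ) ∂μ :=
        integral_mono (integrable_of_mem_Icc hm hI) (integrable_const _) fun ω => (hI ω).2
    _ = μ.real Set.univ := by simp

theorem tvDist_le {μ ν : Measure Ω} {c : ℝ}
    (hc : ∀ h : Ω → ℝ, Measurable h → (∀ ω, h ω ∈ Set.Icc (0 : ℝ) 1) →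
      |∫ ω, h ω ∂μ - ∫ ω, h ω ∂ν| ≤ c) : tvDist μ ν ≤ c := by
  have : Nonempty {h : Ω → ℝ // Measurable h ∧ ∀ ω, h ω ∈ Set.Icc (0 : ℝ) 1} :=
    ⟨⟨fun _ => 0, measurable_const, fun _ => by simp⟩⟩
  exact ciSup_le fun h => hc h.1 h.2.1 h.2.2

theorem abs_integral_sub_le_tvDist {μ ν : Measure Ω} [IsFiniteMeasure μ] [IsFiniteMeasure ν]
    {h : Ω → ℝ} (hm : Measurable h) (hI : ∀ ω, h ω ∈ Set.Icc (0 : ℝ) 1) :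
    |∫ ω, h ω ∂μ - ∫ ω, h ω ∂ν| ≤ tvDist μ ν := by
  refine le_ciSup (f := fun h : {h : Ω → ℝ // Measurable h ∧ ∀ ω, h ω ∈ Set.Icc (0 : ℝ) 1} =>
    |∫ ω, h.1 ω ∂μ - ∫ ω, h.1 ω ∂ν|) ⟨μ.real Set.univ + ν.real Set.univ, ?_⟩ ⟨h, hm, hI⟩
  rintro _ ⟨g, rfl⟩
  have h1 := integral_mem_Icc (μ := μ) g.2.1 g.2.2
  have h2 := integral_mem_Icc (μ := ν) g.2.1 g.2.2
  rw [Set.mem_Icc] at h1 h2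
  exact abs_le.2 ⟨by linarith, by linarith⟩

theorem tvDist_mem_Icc (μ ν : Measure Ω) [IsProbabilityMeasure μ] [IsProbabilityMeasure ν] :
    tvDist μ ν ∈ Set.Icc (0 : ℝ) 1 := by
  refine ⟨Real.iSup_nonneg fun h => abs_nonneg _, tvDist_le fun h hm hI => ?_⟩
  have h1 := integral_mem_Icc (μ := μ) hm hI
  have h2 := integral_mem_Icc (μ := ν) hm hI
  simp only [probReal_univ, Set.mem_Icc] at h1 h2
  exact abs_le.2 ⟨by linarith, by linarith⟩

/-- Total variation distance of two measures with densities with respect to a common measure. -/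
theorem tvDist_withDensity {ξ : Measure Ω} {u v : Ω → ENNReal} (hu : Measurable u)
    (hv : Measurable v) [IsFiniteMeasure (ξ.withDensity u)] [IsFiniteMeasure (ξ.withDensity v)]
    (huv : ξ.withDensity u Set.univ = ξ.withDensity v Set.univ) :
    tvDist (ξ.withDensity u) (ξ.withDensity v) = (∫⁻ ω, (u ω - v ω) ∂ξ).toReal := by
  -- Split off the common part `γ`; the remainders `a` and `b` have equal mass and live on disjoint
  -- sets, so the indicator of `{v < u}` attains the supremum.
  set γ := ξ.withDensity fun ω => min (u ω) (v ω) with hγ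
  set a := ξ.withDensity fun ω => u ω - v ω with ha
  set b := ξ.withDensity fun ω => v ω - u ω with hb
  have h1 : ξ.withDensity u = a + γ := by
    rw [ha, hγ, ← withDensity_add_left (f := fun ω => u ω - v ω) (hu.sub hv)]
    congr 1; ext ω; exact (tsub_add_min).symm
  have h2 : ξ.withDensity v = b + γ := by
    rw [hb, hγ, ← withDensity_add_left (f := fun ω => v ω - u ω) (hv.sub hu)]
    congr 1; ext ω; simp only [Pi.add_apply]; rw [min_comm]; exact (tsub_add_min).symm
  have fa : IsFiniteMeasure a := isFiniteMeasure_of_le _ (h1 ▸ Measure.le_add_right le_rfl)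
  have fγ : IsFiniteMeasure γ := isFiniteMeasure_of_le _ (h1 ▸ Measure.le_add_left le_rfl)
  have fb : IsFiniteMeasure b := isFiniteMeasure_of_le _ (h2 ▸ Measure.le_add_right le_rfl)
  have hab : a Set.univ = b Set.univ := by
    rw [h1, h2, Measure.add_apply, Measure.add_apply] at huv
    exact (ENNReal.add_left_inj (measure_ne_top γ _)).1 huv
  have hreal : a.real Set.univ = b.real Set.univ := congrArg ENNReal.toReal hab
  have hau : (∫⁻ ω, (u ω - v ω) ∂ξ).toReal = a.real Set.univ := by
    rw [measureReal_def, ha, withDensity_apply _ MeasurableSet.univ, Measure.restrict_univ]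
  have hdiff : ∀ h : Ω → ℝ, Measurable h → (∀ ω, h ω ∈ Set.Icc (0 : ℝ) 1) →
      ∫ ω, h ω ∂(a + γ) - ∫ ω, h ω ∂(b + γ) = ∫ ω, h ω ∂a - ∫ ω, h ω ∂b := fun h hh hI => by
    rw [integral_add_measure (integrable_of_mem_Icc hh hI) (integrable_of_mem_Icc hh hI),
      integral_add_measure (integrable_of_mem_Icc hh hI) (integrable_of_mem_Icc hh hI)]
    ring
  rw [hau, h1, h2]
  refine le_antisymm (tvDist_le fun h hh hI => ?_) ?_
  · rw [hdiff h hh hI]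
    have i1 := integral_mem_Icc (μ := a) hh hI
    have i2 := integral_mem_Icc (μ := b) hh hI
    rw [Set.mem_Icc] at i1 i2
    exact abs_le.2 ⟨by linarith, by linarith⟩
  · have hS : MeasurableSet {ω | v ω < u ω} := measurableSet_lt hv hu
    have hh : Measurable ({ω | v ω < u ω}.indicator fun _ => (1 : ℝ)) :=
      measurable_const.indicator hS
    have hI : ∀ ω, ({ω | v ω < u ω}.indicator fun _ => (1 : ℝ)) ω ∈ Set.Icc (0 : ℝ) 1 := by
      intro ω; by_cases hω : ω ∈ {ω | v ω < u ω} <;> simp [hω]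
    refine le_trans ?_ (abs_integral_sub_le_tvDist hh hI)
    rw [hdiff _ hh hI, integral_indicator_const _ hS, integral_indicator_const _ hS]
    have a0 : a {ω | v ω < u ω}ᶜ = 0 := by
      rw [ha, withDensity_apply _ hS.compl]
      exact setLIntegral_eq_zero hS.compl fun ω hω => tsub_eq_zero_of_le (not_lt.1 hω)
    have b0 : b {ω | v ω < u ω} = 0 := by
      rw [hb, withDensity_apply _ hS]
      exact setLIntegral_eq_zero hS fun ω hω => tsub_eq_zero_of_le (le_of_lt hω)
    have a1 : a.real {ω | v ω < u ω} = a.real Set.univ := by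
      rw [measureReal_def, measureReal_def, ← measure_add_measure_compl hS, a0, add_zero]
    rw [a1, measureReal_def b, b0]
    simpa using le_abs_self _

/-- Countable generation provides densities of both kernels with respect to their sum that are
jointly measurable in the parameter and the point; the distance is then a parametric integral of `u
- v`. -/
theorem measurable_tvDist {α : Type*} [MeasurableSpace α] [MeasurableSpace.CountablyGenerated Ω]
    (κ η : Kernel α Ω) [IsMarkovKernel κ] [IsMarkovKernel η] :
    Measurable fun a => tvDist (κ a) (η a) := by
  obtain ⟨u, v, hu, hv, h1, h2⟩ : ∃ u v : α → Ω → ENNReal, Measurable (Function.uncurry u) ∧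
      Measurable (Function.uncurry v) ∧ (∀ a, κ a = ((κ + η) a).withDensity (u a)) ∧
      ∀ a, η a = ((κ + η) a).withDensity (v a) := by
    have hf := Kernel.measurable_rnDerivAux κ (κ + η)
    have hu : Measurable (Function.uncurry fun (a : α) (x : Ω) =>
        ((Kernel.rnDerivAux κ (κ + η) a x).toNNReal : ENNReal)) := by
      unfold Function.uncurry; fun_prop
    have hv : Measurable (Function.uncurry fun (a : α) (x : Ω) =>
        ((1 - Kernel.rnDerivAux κ (κ + η) a x).toNNReal : ENNReal)) := by
      unfold Function.uncurry; fun_prop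
    refine ⟨_, _, hu, hv, fun a => ?_, fun a => ?_⟩
    · rw [← Kernel.withDensity_apply _ hu, Kernel.withDensity_rnDerivAux κ η]
    · rw [← Kernel.withDensity_apply _ hv, Kernel.withDensity_one_sub_rnDerivAux κ η]
  have key : ∀ a, tvDist (κ a) (η a) = (∫⁻ x, (u a x - v a x) ∂((κ + η) a)).toReal := by
    intro a
    have p1 : IsProbabilityMeasure (((κ + η) a).withDensity (u a)) := by
      rw [← h1]; infer_instance
    have p2 : IsProbabilityMeasure (((κ + η) a).withDensity (v a)) := by
      rw [← h2]; infer_instance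
    refine (congrArg₂ tvDist (h1 a) (h2 a)).trans (tvDist_withDensity
      (hu.comp measurable_prodMk_left) (hv.comp measurable_prodMk_left) ?_)
    rw [measure_univ, measure_univ]
  simp_rw [key]
  exact (Measurable.lintegral_kernel_prod_right (κ := κ + η) (f := fun a x => u a x - v a x)
    (hu.sub hv)).ennreal_toReal

variable {α : Type*} [MeasurableSpace α]

theorem measurable_integral_kernel (κ : Kernel α Ω) [IsMarkovKernel κ] {h : Ω → ℝ}
    (hm : Measurable h) : Measurable fun a => ∫ ω, h ω ∂κ a :=
  (hm.stronglyMeasurable.integral_kernel).measurable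

theorem integral_kernel_mem_Icc (κ : Kernel α Ω) [IsMarkovKernel κ] {h : Ω → ℝ}
    (hm : Measurable h) (hI : ∀ ω, h ω ∈ Set.Icc (0 : ℝ) 1) (a : α) :
    ∫ ω, h ω ∂κ a ∈ Set.Icc (0 : ℝ) 1 := by
  simpa using integral_mem_Icc (μ := κ a) hm hI

theorem integral_bind_kernel (μ : Measure α) [IsFiniteMeasure μ] (κ : Kernel α Ω)
    [IsMarkovKernel κ] {h : Ω → ℝ}
    (hm : Measurable h) (hI : ∀ ω, h ω ∈ Set.Icc (0 : ℝ) 1) :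
    ∫ ω, h ω ∂(μ.bind κ) = ∫ a, ∫ ω, h ω ∂κ a ∂μ := by
  have hfin : IsFiniteMeasure ((κ ∘ₖ Kernel.const Unit μ) ()) := inferInstance
  rw [Measure.comp_eq_comp_const_apply, Kernel.integral_comp (integrable_of_mem_Icc hm hI),
    Kernel.const_apply]

/-- Markov kernels contract the total variation distance. -/
theorem tvDist_bind_le (μ ν : Measure α) [IsFiniteMeasure μ] [IsFiniteMeasure ν]
    (κ : Kernel α Ω) [IsMarkovKernel κ] : tvDist (μ.bind κ) (ν.bind κ) ≤ tvDist μ ν := by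
  refine tvDist_le fun h hm hI => ?_
  rw [integral_bind_kernel μ κ hm hI, integral_bind_kernel ν κ hm hI]
  exact abs_integral_sub_le_tvDist (measurable_integral_kernel κ hm)
    (integral_kernel_mem_Icc κ hm hI)

/-- If `μ` and `ν` share the part `γ`, only the remainders `a` and `b` have to be coupled. -/
theorem mul_tvDist_bind_le [MeasurableSpace.CountablyGenerated Ω] {γ a b : Measure α}
    [IsFiniteMeasure γ] [IsFiniteMeasure a] [IsFiniteMeasure b]
    (hab : a.real Set.univ = b.real Set.univ) (κ : Kernel α Ω) [IsMarkovKernel κ] :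
    a.real Set.univ * tvDist ((γ + a).bind κ) ((γ + b).bind κ) ≤
      ∫ z, tvDist (κ z.1) (κ z.2) ∂(a.prod b) := by
  have hD : Measurable fun z : α × α => tvDist (κ z.1) (κ z.2) :=
    measurable_tvDist (κ.comap Prod.fst measurable_fst) (κ.comap Prod.snd measurable_snd)
  have hDI : Integrable (fun z : α × α => tvDist (κ z.1) (κ z.2)) (a.prod b) :=
    integrable_of_mem_Icc hD fun z => tvDist_mem_Icc _ _
  rcases (measureReal_nonneg (μ := a) (s := Set.univ)).eq_or_lt with h0 | h0
  · rw [← h0, zero_mul]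
    exact integral_nonneg fun z => (tvDist_mem_Icc _ _).1
  rw [mul_comm, ← le_div_iff₀ h0]
  refine tvDist_le fun h hm hI => ?_
  rw [le_div_iff₀ h0, integral_bind_kernel _ κ hm hI, integral_bind_kernel _ κ hm hI]
  set F : α → ℝ := fun x => ∫ ω, h ω ∂κ x with hF
  have hFm : Measurable F := measurable_integral_kernel κ hm
  have hFI := integral_kernel_mem_Icc κ hm hI
  rw [integral_add_measure (integrable_of_mem_Icc hFm hFI) (integrable_of_mem_Icc hFm hFI),
    integral_add_measure (integrable_of_mem_Icc hFm hFI) (integrable_of_mem_Icc hFm hFI),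
    add_sub_add_left_eq_sub]
  have i1 : Integrable (fun z : α × α => F z.1) (a.prod b) :=
    integrable_of_mem_Icc (hFm.comp measurable_fst) fun z => hFI _
  have i2 : Integrable (fun z : α × α => F z.2) (a.prod b) :=
    integrable_of_mem_Icc (hFm.comp measurable_snd) fun z => hFI _
  -- Equal masses make the product measure `a.prod b` an unnormalised coupling of the two
  -- remainders.
  have e : (∫ x, F x ∂a - ∫ x, F x ∂b) * a.real Set.univ = ∫ z, (F z.1 - F z.2) ∂(a.prod b) := by
    rw [integral_sub i1 i2, integral_fun_fst, integral_fun_snd, ← hab]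
    simp only [smul_eq_mul]; ring
  rw [show ∀ r : ℝ, |r| * a.real Set.univ = |r * a.real Set.univ| from fun r => by
    rw [abs_mul, abs_of_pos h0], e]
  refine (abs_integral_le_integral_abs).trans (integral_mono (i1.sub i2).abs hDI fun z => ?_)
  exact abs_integral_sub_le_tvDist hm hI

theorem tvDist_bind_le_integral [MeasurableSpace.CountablyGenerated Ω] (μ ν : Measure α)
    [IsProbabilityMeasure μ] [IsProbabilityMeasure ν] (κ : Kernel α Ω) [IsMarkovKernel κ] :
    tvDist (μ.bind κ) (ν.bind κ) ≤ ∫ z, tvDist (κ z.1) (κ z.2) ∂(μ.prod ν) := by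
  simpa using mul_tvDist_bind_le (γ := (0 : Measure α)) (a := μ) (b := ν) (by simp) κ

end TotalVariation

/-! ### Convergence of chains whose transition laws dominate the invariant law. -/

theorem bind_prod_parallelComp {α β γ δ : Type*} [MeasurableSpace α] [MeasurableSpace β]
    [MeasurableSpace γ] [MeasurableSpace δ] (μ : Measure α) (ν : Measure β) [SFinite μ] [SFinite ν]
    (κ : Kernel α γ) (η : Kernel β δ) [IsSFiniteKernel κ] [IsSFiniteKernel η] :
    (μ.prod ν).bind (κ ∥ₖ η) = (μ.bind κ).prod (ν.bind η) := by
  rw [Measure.prod_comp_left, Measure.prod_comp_right, Measure.comp_assoc,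
    Kernel.parallelComp_comp_parallelComp, Kernel.comp_id, Kernel.id_comp]

section Ergodic

variable {E : Type*} [MeasurableSpace E]

/-- A bounded function that is subharmonic for an invariant, irreducible Markov kernel is almost
surely constant. -/
theorem ae_eq_const_of_le_integral {T : Kernel E E} [IsMarkovKernel T] {ρ : Measure E}
    [IsProbabilityMeasure ρ] (hT : T.Invariant ρ) (hac : ∀ z, ρ ≪ T z) {g : E → ℝ}
    (hg : Measurable g) (hI : ∀ z, g z ∈ Set.Icc (0 : ℝ) 1) (hle : ∀ z, g z ≤ ∫ z', g z' ∂T z) :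
    ∃ c, ∀ᵐ z ∂ρ, g z = c := by
  have hsnd : (ρ ⊗ₘ T).map Prod.snd = ρ := by
    have := Measure.snd_compProd ρ T
    rw [Measure.snd] at this
    exact this.trans hT
  have hfst : (ρ ⊗ₘ T).map Prod.fst = ρ := Measure.fst_compProd ρ T
  have hsq : ∀ z, g z ^ 2 ∈ Set.Icc (0 : ℝ) 1 := fun z =>
    ⟨sq_nonneg _, pow_le_one₀ (hI z).1 (hI z).2⟩
  have hmul : ∀ z : E × E, g z.1 * g z.2 ∈ Set.Icc (0 : ℝ) 1 := fun z =>
    ⟨mul_nonneg (hI _).1 (hI _).1, mul_le_one₀ (hI _).2 (hI _).1 (hI _).2⟩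
  have i1 : Integrable (fun z : E × E => g z.1 ^ 2) (ρ ⊗ₘ T) :=
    integrable_of_mem_Icc (by fun_prop) fun z => hsq _
  have i2 : Integrable (fun z : E × E => g z.2 ^ 2) (ρ ⊗ₘ T) :=
    integrable_of_mem_Icc (by fun_prop) fun z => hsq _
  have i3 : Integrable (fun z : E × E => g z.1 * g z.2) (ρ ⊗ₘ T) :=
    integrable_of_mem_Icc (by fun_prop) hmul
  have e1 : ∫ z, g z.1 ^ 2 ∂(ρ ⊗ₘ T) = ∫ z, g z ^ 2 ∂ρ := by
    conv_rhs => rw [← hfst]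
    rw [integral_map measurable_fst.aemeasurable (by fun_prop)]
  have e2 : ∫ z, g z.2 ^ 2 ∂(ρ ⊗ₘ T) = ∫ z, g z ^ 2 ∂ρ := by
    conv_rhs => rw [← hsnd]
    rw [integral_map measurable_snd.aemeasurable (by fun_prop)]
  have e3 : ∫ z, g z ^ 2 ∂ρ ≤ ∫ z, g z.1 * g z.2 ∂(ρ ⊗ₘ T) := by
    rw [Measure.integral_compProd i3]
    simp only [integral_const_mul]
    refine integral_mono (integrable_of_mem_Icc (by fun_prop) hsq)
      (integrable_of_mem_Icc
        (hg.mul (measurable_integral_kernel T hg)) fun z => ?_) fun z => ?_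
    · have hz := integral_kernel_mem_Icc T hg hI z
      exact ⟨mul_nonneg (hI z).1 hz.1, mul_le_one₀ (hI z).2 hz.1 hz.2⟩
    simp only [sq]
    exact mul_le_mul_of_nonneg_left (hle z) (hI z).1
  have i12 : Integrable (fun z : E × E => g z.1 ^ 2 + g z.2 ^ 2) (ρ ⊗ₘ T) := i1.add i2
  have i4 : Integrable (fun z : E × E => g z.1 ^ 2 + g z.2 ^ 2 - 2 * (g z.1 * g z.2)) (ρ ⊗ₘ T) :=
    i12.sub (i3.const_mul 2)
  -- The mean of (g(z) - g(z'))² over a stationary transition is 2∫g² - 2∫g·Tg, which is at most 0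
  -- because 0 ≤ g ≤ Tg. So `g` is constant along almost every transition, and one good `z` suffices
  -- because `T z` dominates `ρ`.
  have h0 : ∫ z : E × E, (g z.1 ^ 2 + g z.2 ^ 2 - 2 * (g z.1 * g z.2)) ∂(ρ ⊗ₘ T) = 0 := by
    refine le_antisymm ?_ (integral_nonneg fun z => ?_)
    · rw [integral_sub i12 (i3.const_mul 2), integral_add i1 i2, integral_const_mul]
      linarith
    · simp only [Pi.zero_apply]
      nlinarith [sq_nonneg (g z.1 - g z.2)]
  rw [integral_eq_zero_iff_of_nonneg (fun z => by
    simp only [Pi.zero_apply]; nlinarith [sq_nonneg (g z.1 - g z.2)])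
    i4] at h0
  have h1 := Measure.ae_ae_of_ae_compProd h0
  obtain ⟨z, hz⟩ := h1.exists
  refine ⟨g z, (hac z).ae_le ?_⟩
  filter_upwards [hz] with z' hz'
  simp only [Pi.zero_apply] at hz'
  have : (g z' - g z) ^ 2 = 0 := by linarith [hz', (by ring : (g z' - g z) ^ 2 =
    g z ^ 2 + g z' ^ 2 - 2 * (g z * g z'))]
  exact sub_eq_zero.1 (pow_eq_zero_iff (two_ne_zero) |>.1 this)

/-- Two probability measures dominating a common non-zero measure share some mass. -/
theorem exists_common_part {μ ν π : Measure E} [IsProbabilityMeasure μ] [IsProbabilityMeasure ν]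
    (hπ : π ≠ 0) (hμ : π ≪ μ) (hν : π ≪ ν) :
    ∃ γ a b : Measure E, μ = γ + a ∧ ν = γ + b ∧ IsFiniteMeasure γ ∧ IsFiniteMeasure a ∧
      IsFiniteMeasure b ∧ a.real Set.univ = b.real Set.univ ∧ 0 < a.real Set.univ ∧
      a.real Set.univ < 1 := by
  have hne : μ ⊓ ν ≠ 0 := fun h => by
    have hs : μ ⟂ₘ ν := Measure.mutuallySingular_iff_disjoint.2
      (disjoint_iff.2 h)
    exact hπ ((Measure.MutuallySingular.self_iff π).1 (hs.mono_ac hμ hν))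
  -- The factor 1/2 keeps the remainders non-zero even when `μ = ν`.
  let γ : Measure E := (2⁻¹ : ENNReal) • (μ ⊓ ν)
  have hle : γ ≤ μ ⊓ ν := fun s => by
    simp only [γ, Measure.smul_apply, smul_eq_mul]
    exact mul_le_of_le_one_left' (by simp)
  have f0 : IsFiniteMeasure (μ ⊓ ν) := isFiniteMeasure_of_le μ inf_le_left
  have fγ : IsFiniteMeasure γ := isFiniteMeasure_of_le _ hle
  have hμ' : μ = γ + (μ - γ) := by
    rw [add_comm, Measure.sub_add_cancel_of_le (hle.trans inf_le_left)]
  have hν' : ν = γ + (ν - γ) := by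
    rw [add_comm, Measure.sub_add_cancel_of_le (hle.trans inf_le_right)]
  have r1 : γ.real Set.univ + (μ - γ).real Set.univ = 1 := by
    rw [← measureReal_add_apply, ← hμ', probReal_univ]
  have r2 : γ.real Set.univ + (ν - γ).real Set.univ = 1 := by
    rw [← measureReal_add_apply, ← hν', probReal_univ]
  have r3 : γ.real Set.univ = 2⁻¹ * (μ ⊓ ν).real Set.univ := by
    simp [γ, measureReal_ennreal_smul_apply]
  have r4 : (μ ⊓ ν).real Set.univ ≤ 1 := by
    rw [← probReal_univ (μ := μ), measureReal_def, measureReal_def]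
    exact ENNReal.toReal_mono (measure_ne_top _ _) ((inf_le_left : μ ⊓ ν ≤ μ) _)
  have r5 : 0 < (μ ⊓ ν).real Set.univ := by
    rw [measureReal_def, ENNReal.toReal_pos_iff]
    exact ⟨pos_iff_ne_zero.2 (Measure.measure_univ_ne_zero.2 hne), measure_lt_top _ _⟩
  exact ⟨γ, μ - γ, ν - γ, hμ', hν', fγ, inferInstance, inferInstance, by linarith, by linarith,
    by linarith⟩

/-- An invariant Markov semigroup whose transition probabilities dominate the invariant
distribution converges to it in total variation, from almost every initial state. -/
theorem ae_tendsto_tvDist_of_invariant [MeasurableSpace.CountablyGenerated E]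
    {κ : ℕ → Kernel E E} [∀ t, IsMarkovKernel (κ t)] {π : Measure E} [IsProbabilityMeasure π]
    (hκ : ∀ s t, κ (s + t) = κ s ∘ₖ κ t) (hinv : ∀ t, (κ t).Invariant π)
    (hac : ∀ x, π ≪ κ 1 x) :
    ∀ᵐ x ∂π, Filter.Tendsto (fun t => tvDist (κ t x) π) Filter.atTop (nhds 0) := by
  let d : ℕ → E × E → ℝ := fun t z => tvDist (κ t z.1) (κ t z.2)
  have dm : ∀ t, Measurable (d t) := fun t =>
    measurable_tvDist ((κ t).comap Prod.fst measurable_fst) ((κ t).comap Prod.snd measurable_snd)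
  have dI : ∀ t z, d t z ∈ Set.Icc (0 : ℝ) 1 := fun t z => tvDist_mem_Icc _ _
  have anti : ∀ z, Antitone fun t => d t z := fun z => antitone_nat_of_succ_le fun t => by
    simp only [d]
    rw [add_comm t 1, hκ, Kernel.comp_apply, Kernel.comp_apply]
    exact tvDist_bind_le _ _ _
  have bdd : ∀ z, BddBelow (Set.range fun t => d t z) := fun z =>
    ⟨0, by rintro _ ⟨t, rfl⟩; exact (dI t z).1⟩
  let g : E × E → ℝ := fun z => ⨅ t, d t z
  have lim : ∀ z, Filter.Tendsto (fun t => d t z) Filter.atTop (nhds (g z)) := fun z =>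
    tendsto_atTop_ciInf (anti z) (bdd z)
  have gm : Measurable g := measurable_of_tendsto_metrizable dm (tendsto_pi_nhds.2 lim)
  have gI : ∀ z, g z ∈ Set.Icc (0 : ℝ) 1 := fun z =>
    ⟨le_ciInf fun t => (dI t z).1, (ciInf_le (bdd z) 0).trans (dI 0 z).2⟩
  have dom : ∀ (μ : Measure (E × E)) [IsFiniteMeasure μ],
      Filter.Tendsto (fun t => ∫ z, d t z ∂μ) Filter.atTop (nhds (∫ z, g z ∂μ)) := fun μ _ => by
    refine tendsto_integral_of_dominated_convergence (fun _ => 1)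
      (fun t => (dm t).aestronglyMeasurable) (integrable_const _) (fun t => ae_of_all _ fun z => ?_)
      (ae_of_all _ lim)
    rw [Real.norm_eq_abs, abs_of_nonneg (dI t z).1]
    exact (dI t z).2
  have ginv : (κ 1 ∥ₖ κ 1).Invariant (π.prod π) := by
    rw [Kernel.Invariant, bind_prod_parallelComp, hinv 1]
  have gle : ∀ z, g z ≤ ∫ z', g z' ∂(κ 1 ∥ₖ κ 1) z := fun z => by
    refine ge_of_tendsto (dom _) (Filter.Eventually.of_forall fun t => ?_)
    refine (ciInf_le (bdd z) (t + 1)).trans ?_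
    simp only [d]
    rw [hκ, Kernel.comp_apply, Kernel.comp_apply, Kernel.parallelComp_apply]
    exact tvDist_bind_le_integral _ _ _
  obtain ⟨c, hc⟩ := ae_eq_const_of_le_integral ginv
    (fun z => by rw [Kernel.parallelComp_apply]; exact (hac z.1).prod (hac z.2)) gm gI gle
  -- The remainders `a`, `b` used below need not be dominated by `π`; they are dominated by the
  -- one-step laws, so `g = c` is needed almost everywhere for those, and invariance supplies it.
  have hcc : ∀ᵐ z ∂(π.prod π), ∀ᵐ z' ∂(κ 1 z.1).prod (κ 1 z.2), g z' = c := by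
    have : ∀ᵐ z ∂((π.prod π).bind (κ 1 ∥ₖ κ 1)), g z = c := by rw [ginv]; exact hc
    filter_upwards [Measure.ae_ae_of_ae_comp this] with z hz
    rwa [Kernel.parallelComp_apply] at hz
  have hg0 : ∀ᵐ z ∂(π.prod π), g z = 0 := by
    filter_upwards [hc, hcc] with z hz hz'
    obtain ⟨γ, a, b, h1, h2, fγ, fa, fb, hab, hpos, hlt⟩ :=
      exists_common_part (IsProbabilityMeasure.ne_zero π) (hac z.1) (hac z.2)
    have hle : ∀ t, a.real Set.univ * d (t + 1) z ≤ ∫ z', d t z' ∂(a.prod b) := fun t => by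
      simp only [d]
      rw [hκ, Kernel.comp_apply, Kernel.comp_apply, h1, h2]
      exact mul_tvDist_bind_le hab _
    -- With ε the mass of `a` and `b`, the limit reads ε c ≤ ε² c, where 0 < ε < 1.
    have hlim := le_of_tendsto_of_tendsto' (((lim z).comp
      (Filter.tendsto_add_atTop_nat 1)).const_mul (a.real Set.univ)) (dom (a.prod b)) hle
    have hgc : ∀ᵐ z' ∂(a.prod b), g z' = c := by
      refine Measure.AbsolutelyContinuous.ae_le ?_ hz'
      exact Measure.AbsolutelyContinuous.prod
        (Measure.absolutelyContinuous_of_le (by rw [h1]; exact Measure.le_add_left le_rfl))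
        (Measure.absolutelyContinuous_of_le (by rw [h2]; exact Measure.le_add_left le_rfl))
    rw [integral_congr_ae hgc, integral_const, hz, smul_eq_mul, ← Set.univ_prod_univ,
      measureReal_prod_prod, ← hab] at hlim
    have hc0 : 0 ≤ c := hz ▸ (gI z).1
    rw [hz]
    refine le_antisymm (not_lt.1 fun hcpos => ?_) hc0
    have : a.real Set.univ * c < a.real Set.univ * c := by
      refine hlim.trans_lt ?_
      nlinarith [mul_pos hpos hcpos]
    exact lt_irrefl _ this
  filter_upwards [Measure.ae_ae_of_ae_prod hg0] with x hx
  have hlim := dom ((Measure.dirac x).prod π)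
  have hzero : ∫ z, g z ∂((Measure.dirac x).prod π) = 0 := by
    rw [Measure.dirac_prod, integral_map (by fun_prop) gm.aestronglyMeasurable]
    rw [integral_congr_ae hx, integral_zero]
  rw [hzero] at hlim
  refine squeeze_zero (fun t => (tvDist_mem_Icc _ _).1) (fun t => ?_) hlim
  have := tvDist_bind_le_integral (Measure.dirac x) π (κ t)
  rwa [Measure.dirac_bind (κ t).measurable, hinv t] at this

end Ergodic

/-! ### Resampling coordinates of product measures. -/

section Pi

variable {X : Type*} [MeasurableSpace X] {ι : Type*} [DecidableEq ι]

theorem measurable_update_update (i j : ι) :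
    Measurable fun z : (ι → X) × X × X => Function.update (Function.update z.1 i z.2.1) j z.2.2 :=
  measurable_update'.comp (f := fun z : (ι → X) × X × X => (Function.update z.1 i z.2.1, z.2.2))
    ((measurable_update'.comp (f := fun z : (ι → X) × X × X => (z.1, z.2.1)) (by fun_prop)).prodMk
      (by fun_prop))

instance isProbabilityMeasure_update (ν : ι → Measure X) [∀ n, IsProbabilityMeasure (ν n)] (i : ι)
    (μ : Measure X) [IsProbabilityMeasure μ] (n : ι) :
    IsProbabilityMeasure (Function.update ν i μ n) := by
  rcases eq_or_ne n i with rfl | h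
  · rw [Function.update_self]; infer_instance
  · rw [Function.update_of_ne h]; infer_instance

variable [Fintype ι]

theorem map_update_prod_pi (ν : ι → Measure X) [∀ n, IsProbabilityMeasure (ν n)] (i : ι)
    (μ : Measure X) [IsProbabilityMeasure μ] :
    ((Measure.pi ν).prod μ).map (fun z : (ι → X) × X => Function.update z.1 i z.2) =
      Measure.pi (Function.update ν i μ) := by
  refine (Measure.pi_eq fun s hs => ?_).symm
  have hpre : (fun z : (ι → X) × X => Function.update z.1 i z.2) ⁻¹' Set.univ.pi s =
      (Set.univ.pi (Function.update s i Set.univ)) ×ˢ s i := by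
    ext z
    simp only [Set.mem_preimage, Set.mem_pi, Set.mem_univ, true_imp_iff, Set.mem_prod]
    constructor
    · intro h
      refine ⟨fun n => ?_, by simpa using h i⟩
      rcases eq_or_ne n i with rfl | hn
      · simp
      · simpa [hn] using h n
    · rintro ⟨h, hi⟩ n
      rcases eq_or_ne n i with rfl | hn
      · simpa using hi
      · simpa [hn] using h n
  rw [Measure.map_apply measurable_update' (MeasurableSet.univ_pi hs), hpre, Measure.prod_prod,
    Measure.pi_pi, ← Finset.mul_prod_erase _ _ (Finset.mem_univ i),
    ← Finset.mul_prod_erase (a := i) _ (fun n => Function.update ν i μ n (s n)) (Finset.mem_univ i),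
    Function.update_self, Function.update_self, measure_univ, one_mul, mul_comm]
  congr 1
  refine Finset.prod_congr rfl fun n hn => ?_
  rw [Function.update_of_ne (Finset.ne_of_mem_erase hn),
    Function.update_of_ne (Finset.ne_of_mem_erase hn)]

theorem lintegral_pi_update (ν : ι → Measure X) [∀ n, IsProbabilityMeasure (ν n)] (i : ι)
    (μ : Measure X) [IsProbabilityMeasure μ] {f : (ι → X) → ENNReal} (hf : Measurable f) :
    ∫⁻ x, f x ∂Measure.pi (Function.update ν i μ) =
      ∫⁻ y, ∫⁻ a, f (Function.update y i a) ∂μ ∂Measure.pi ν := by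
  rw [← map_update_prod_pi, lintegral_map hf measurable_update',
    lintegral_prod (fun z : (ι → X) × X => f (Function.update z.1 i z.2))
      (hf.comp measurable_update').aemeasurable]

theorem lintegral_pi_update_update (ν : ι → Measure X) [∀ n, IsProbabilityMeasure (ν n)] (i j : ι)
    (μ₁ μ₂ : Measure X) [IsProbabilityMeasure μ₁] [IsProbabilityMeasure μ₂]
    {f : (ι → X) → ENNReal} (hf : Measurable f) :
    ∫⁻ x, f x ∂Measure.pi (Function.update (Function.update ν i μ₁) j μ₂) =
      ∫⁻ y, ∫⁻ r, f (Function.update (Function.update y i r.1) j r.2) ∂(μ₁.prod μ₂)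
        ∂Measure.pi ν := by
  rw [lintegral_pi_update _ _ _ hf, lintegral_pi_update _ _ _
    (Measurable.lintegral_prod_right (f := fun y a => f (Function.update y j a))
      (hf.comp measurable_update'))]
  refine lintegral_congr fun y => ?_
  rw [lintegral_prod]
  exact (hf.comp ((measurable_update_update i j).comp measurable_prodMk_left)).aemeasurable

end Pi

/-! ### Path kernels and their starting points. -/

/-- If the path sampled from `κ a` almost surely remembers its initial state `a`, that state can
be read off the path. -/
theorem lintegral_eq_lintegral_start {X Y : Type*} [MeasurableSpace X] [MeasurableSpace Y]
    {κ : Kernel X Y} [IsMarkovKernel κ] {s : Y → X} (hs : Measurable s)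
    (hκ : κ.map s = Kernel.id) {G : X × Y → ENNReal} (hG : Measurable G) (a : X) :
    ∫⁻ p, G (a, p) ∂κ a = ∫⁻ p, G (s p, p) ∂κ a := by
  have hmeas : Measurable fun p => (s p, p) := hs.prodMk measurable_id
  have hd : (κ a).map s = Measure.dirac a := by
    rw [← Kernel.map_apply _ hs, hκ, Kernel.id_apply]
  -- Singletons need not be measurable, so `s p = a` is not used as an almost sure identity; the
  -- joint laws are compared on rectangles, where `κ a (s ⁻¹' B)` is 0 or 1.
  have h : (Measure.dirac a).prod (κ a) = (κ a).map fun p => (s p, p) := by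
    refine Measure.prod_eq fun B C hB hC => ?_
    rw [Measure.map_apply hmeas (hB.prod hC), Measure.dirac_apply' _ hB]
    have hpre : (fun p => (s p, p)) ⁻¹' B ×ˢ C = s ⁻¹' B ∩ C := by ext p; simp
    have hB' : κ a (s ⁻¹' B) = B.indicator 1 a := by
      rw [← Measure.map_apply hs hB, hd, Measure.dirac_apply' _ hB]
    rw [hpre]
    by_cases ha : a ∈ B
    · rw [Set.indicator_of_mem ha] at hB' ⊢
      have : κ a (s ⁻¹' B)ᶜ = 0 := (prob_compl_eq_zero_iff (hs hB)).2 hB'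
      rw [Pi.one_apply, one_mul, Set.inter_comm]
      exact measure_inter_conull this
    · rw [Set.indicator_of_notMem ha] at hB' ⊢
      rw [zero_mul]
      exact measure_mono_null Set.inter_subset_left hB'
  rw [← lintegral_map (f := fun z : X × Y => G z) hG hmeas, ← h,
    lintegral_prod _ hG.aemeasurable, lintegral_dirac' _ (Measurable.lintegral_prod_right
      (f := fun x y => G (x, y)) hG)]

section PathKernel

variable {X : Type*} [MeasurableSpace X]

theorem measurable_snoc (K : ℕ) :
    Measurable fun q : (Fin (K + 1) → X) × X => (Fin.snoc q.1 q.2 : Fin (K + 2) → X) := by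
  refine measurable_pi_iff.2 fun k => ?_
  induction k using Fin.lastCases with
  | last => simpa using measurable_snd
  | cast k => simp only [Fin.snoc_castSucc]; fun_prop

instance isMarkovKernel_pathKernel : ∀ (K : ℕ) (R : Fin K → Kernel X X)
    [∀ k, IsMarkovKernel (R k)], IsMarkovKernel (pathKernel K R)
  | 0, _, _ => Kernel.IsMarkovKernel.map _ (by fun_prop)
  | K + 1, R, _ => by
      have := isMarkovKernel_pathKernel K fun k => R k.castSucc
      exact Kernel.IsMarkovKernel.map _ (measurable_snoc K)

theorem map_zero_pathKernel (K : ℕ) (R : Fin K → Kernel X X) [∀ k, IsMarkovKernel (R k)] :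
    (pathKernel K R).map (fun p => p 0) = Kernel.id := by
  induction K with
  | zero =>
    rw [pathKernel, ← Kernel.map_comp_right _ (by fun_prop) (by fun_prop)]
    exact Kernel.map_id _
  | succ K ih =>
    rw [pathKernel, ← Kernel.map_comp_right _ (measurable_snoc K) (by fun_prop)]
    have : (fun p : Fin (K + 2) → X => p 0) ∘
        (fun q : (Fin (K + 1) → X) × X => (Fin.snoc q.1 q.2 : Fin (K + 2) → X)) =
        (fun p => p 0) ∘ Prod.fst := by
      ext q
      exact Fin.snoc_castSucc (α := fun _ => X) q.2 q.1 0
    rw [this, Kernel.map_comp_right _ measurable_fst (by fun_prop), ← Kernel.fst_eq,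
      Kernel.fst_compProd, ih]

end PathKernel

/-! ### The law of one accelerated swap. -/

theorem lintegral_unitInterval_ite {a : ℝ} (h0 : 0 ≤ a) (h1 : a ≤ 1) (c₁ c₂ : ENNReal) :
    ∫⁻ u : unitInterval, (if (u : ℝ) < a then c₁ else c₂) =
      ENNReal.ofReal a * c₁ + (1 - ENNReal.ofReal a) * c₂ := by
  have hS : MeasurableSet {u : unitInterval | (u : ℝ) < a} :=
    measurableSet_lt (by fun_prop) measurable_const
  have hv : volume {u : unitInterval | (u : ℝ) < a} = ENNReal.ofReal a :=
    unitInterval.volume_Iio ⟨a, h0, h1⟩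
  have e1 : ∫⁻ u : unitInterval in {u : unitInterval | (u : ℝ) < a},
      (if (u : ℝ) < a then c₁ else c₂) =
      ∫⁻ _ in {u : unitInterval | (u : ℝ) < a}, c₁ :=
    setLIntegral_congr_fun hS fun u hu => if_pos hu
  have e2 : ∫⁻ u : unitInterval in {u : unitInterval | (u : ℝ) < a}ᶜ,
      (if (u : ℝ) < a then c₁ else c₂) =
      ∫⁻ _ in {u : unitInterval | (u : ℝ) < a}ᶜ, c₂ :=
    setLIntegral_congr_fun hS.compl fun u hu => if_neg hu
  rw [← lintegral_add_compl _ hS, e1, e2, setLIntegral_const, setLIntegral_const,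
    prob_compl_eq_one_sub hS, hv, mul_comm, mul_comm c₂]

namespace APT

variable {X : Type*} [MeasurableSpace X] {N K : ℕ} (A : APT X N K)

instance (i : Fin N) : IsMarkovKernel (A.fwdPath i) := isMarkovKernel_pathKernel K (A.P i)

instance (i : Fin N) : IsMarkovKernel (A.bwdPath i) :=
  Kernel.IsMarkovKernel.map _ (by fun_prop)

theorem map_fwdPath (i : Fin N) : (A.fwdPath i).map (fun p => p 0) = Kernel.id :=
  map_zero_pathKernel K _

theorem map_bwdPath (i : Fin N) : (A.bwdPath i).map (fun p => p (Fin.last K)) = Kernel.id := by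
  rw [bwdPath, ← Kernel.map_comp_right _ (by fun_prop) (by fun_prop)]
  convert map_zero_pathKernel K fun k => A.Q i k.rev using 2
  ext p
  simp

instance (i : Fin N) : IsMarkovKernel (A.swapWithFlag i) :=
  Kernel.IsMarkovKernel.map _ (A.measurable_swapUpdate i)

instance (i : Fin N) : IsMarkovKernel (A.swap i) := by unfold swap; infer_instance

instance : IsMarkovKernel A.exploration :=
  ⟨fun x => by change IsProbabilityMeasure (Measure.pi fun n => A.explore n (x n)); infer_instance⟩

instance (t m : ℕ) : IsMarkovKernel (A.stepUpTo t m) := by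
  induction m with
  | zero => rw [stepUpTo]; infer_instance
  | succ m ih => rw [stepUpTo]; split_ifs <;> infer_instance

instance (t : ℕ) : IsMarkovKernel (A.step t) := by unfold step; infer_instance

instance (t : ℕ) : IsMarkovKernel (A.lawAt t) := by
  induction t with
  | zero => rw [lawAt]; infer_instance
  | succ t ih => rw [lawAt]; infer_instance

theorem measurable_work (i : Fin N) : Measurable (A.work i) :=
  measurable_const.sub (Measure.measurable_rnDeriv _ _).ennreal_toReal.log

theorem measurable_acceptProb (i : Fin N) :
    Measurable fun r : (Fin (K + 1) → X) × (Fin (K + 1) → X) => A.acceptProb i r.1 r.2 := by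
  have := A.measurable_work i
  unfold acceptProb
  fun_prop

theorem acceptProb_pos (i : Fin N) (p q : Fin (K + 1) → X) : 0 < A.acceptProb i p q :=
  Real.exp_pos _

theorem acceptProb_le_one (i : Fin N) (p q : Fin (K + 1) → X) : A.acceptProb i p q ≤ 1 :=
  Real.exp_le_one_iff.2 (min_le_left _ _)

/-- Replace the coordinates `i` and `i + 1` of a state. -/
def updatePair (i : Fin N) (y : Fin (N + 1) → X) (a b : X) : Fin (N + 1) → X :=
  Function.update (Function.update y i.castSucc a) i.succ b

theorem measurable_updatePair (i : Fin N) {α : Type*} [MeasurableSpace α]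
    {f : α → Fin (N + 1) → X} {g h : α → X} (hf : Measurable f) (hg : Measurable g)
    (hh : Measurable h) : Measurable fun a => updatePair i (f a) (g a) (h a) :=
  (measurable_update_update i.castSucc i.succ).comp (hf.prodMk (hg.prodMk hh))

theorem updatePair_updatePair {Y : Type*} (i : Fin N) (y : Fin (N + 1) → Y) (a b a' b' : Y) :
    updatePair i (updatePair i y a b) a' b' = updatePair i y a' b' := by
  ext n
  simp only [updatePair, Function.update_apply]
  split_ifs <;> rfl

/-- Integration of `g` against the outcome of the swap number `i + 1`, given the state `x`, the
forward path `r.1` and the backward path `r.2`. -/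
def swapOutcome (i : Fin N) (g : (Fin (N + 1) → X) × Bool → ENNReal) (x : Fin (N + 1) → X)
    (r : (Fin (K + 1) → X) × (Fin (K + 1) → X)) : ENNReal :=
  ENNReal.ofReal (A.acceptProb i r.1 r.2) * g (updatePair i x (r.2 0) (r.1 (Fin.last K)), true) +
    (1 - ENNReal.ofReal (A.acceptProb i r.1 r.2)) * g (x, false)

theorem measurable_swapOutcome (i : Fin N) {g : (Fin (N + 1) → X) × Bool → ENNReal}
    (hg : Measurable g) {α : Type*} [MeasurableSpace α] {f : α → Fin (N + 1) → X}
    {h : α → (Fin (K + 1) → X) × (Fin (K + 1) → X)} (hf : Measurable f) (hh : Measurable h) :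
    Measurable fun a => A.swapOutcome i g (f a) (h a) := by
  have ha : Measurable fun a => ENNReal.ofReal (A.acceptProb i (h a).1 (h a).2) :=
    ((A.measurable_acceptProb i).comp hh).ennreal_ofReal
  have hu : Measurable fun a => updatePair i (f a) ((h a).2 0) ((h a).1 (Fin.last K)) :=
    measurable_updatePair i hf (by fun_prop) (by fun_prop)
  unfold swapOutcome
  exact (ha.mul (hg.comp (hu.prodMk measurable_const))).add
    ((measurable_const.sub ha).mul (hg.comp (hf.prodMk measurable_const)))

theorem lintegral_swapWithFlag_apply (i : Fin N) {g : (Fin (N + 1) → X) × Bool → ENNReal}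
    (hg : Measurable g) (x : Fin (N + 1) → X) :
    ∫⁻ z, g z ∂A.swapWithFlag i x = ∫⁻ r, A.swapOutcome i g x r
      ∂(A.fwdPath i ∥ₖ A.bwdPath i) (x i.castSucc, x i.succ) := by
  have hg' := hg.comp (A.measurable_swapUpdate i)
  rw [swapWithFlag, Kernel.lintegral_map _ (A.measurable_swapUpdate i) _ hg,
    Kernel.lintegral_id_prod (f := fun z => g (A.swapUpdate i z)) hg', Kernel.prod_apply,
    lintegral_prod (fun b => g (A.swapUpdate i (x, b)))
      (hg'.comp measurable_prodMk_left).aemeasurable, Kernel.prod_apply,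
    Kernel.parallelComp_apply, Kernel.comap_apply, Kernel.comap_apply]
  refine lintegral_congr fun r => ?_
  rw [Kernel.const_apply, swapOutcome, ← lintegral_unitInterval_ite (A.acceptProb_pos i _ _).le
    (A.acceptProb_le_one i _ _)]
  refine lintegral_congr fun u => ?_
  simp only [swapUpdate, updatePair]
  split_ifs <;> rfl

/-- The joint law of the state and of the two paths of a swap, when the coordinates of the state
are independent: the two paths may be drawn first and their starting points put into the state. -/
theorem lintegral_bind_swapWithFlag (i : Fin N) (ν : Fin (N + 1) → Measure X)
    [∀ n, IsProbabilityMeasure (ν n)] {g : (Fin (N + 1) → X) × Bool → ENNReal}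
    (hg : Measurable g) :
    ∫⁻ z, g z ∂((Measure.pi ν).bind (A.swapWithFlag i)) =
      ∫⁻ y, ∫⁻ r, A.swapOutcome i g (updatePair i y (r.1 0) (r.2 (Fin.last K))) r
        ∂(((ν i.castSucc).bind (A.fwdPath i)).prod ((ν i.succ).bind (A.bwdPath i)))
        ∂Measure.pi ν := by
  set κ := A.fwdPath i ∥ₖ A.bwdPath i with hκ
  have hne : i.castSucc ≠ i.succ := Fin.castSucc_lt_succ.ne
  have hs : Measurable fun r : (Fin (K + 1) → X) × (Fin (K + 1) → X) =>
      (r.1 0, r.2 (Fin.last K)) := by fun_prop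
  have hstart : κ.map (fun r => (r.1 0, r.2 (Fin.last K))) = Kernel.id := by
    ext1 ab
    have h1 : (A.fwdPath i ab.1).map (fun p => p 0) = Measure.dirac ab.1 := by
      rw [← Kernel.map_apply _ (by fun_prop), A.map_fwdPath, Kernel.id_apply]
    have h2 : (A.bwdPath i ab.2).map (fun p => p (Fin.last K)) = Measure.dirac ab.2 := by
      rw [← Kernel.map_apply _ (by fun_prop), A.map_bwdPath, Kernel.id_apply]
    rw [Kernel.map_apply _ hs, hκ, Kernel.parallelComp_apply, Kernel.id_apply,
      ← Measure.dirac_prod_dirac, ← h1, ← h2,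
      Measure.map_prod_map _ _ (by fun_prop) (by fun_prop)]
    rfl
  -- Trivial updates present the two coordinates of the swap as resampled independently of the
  -- others.
  have hν : Function.update (Function.update ν i.castSucc (ν i.castSucc)) i.succ (ν i.succ) =
      ν := by
    rw [Function.update_eq_self, Function.update_eq_self]
  rw [Measure.lintegral_bind (A.swapWithFlag i).aemeasurable hg.aemeasurable]
  conv_lhs => rw [← hν]
  simp_rw [A.lintegral_swapWithFlag_apply i hg, ← hκ]
  have hF : Measurable fun x : Fin (N + 1) → X =>
      ∫⁻ r, A.swapOutcome i g x r ∂κ (x i.castSucc, x i.succ) :=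
    Measurable.lintegral_kernel_prod_right (κ := κ.comap (fun x : Fin (N + 1) → X =>
      (x i.castSucc, x i.succ)) (by fun_prop))
      (A.measurable_swapOutcome i hg measurable_fst measurable_snd)
  rw [lintegral_pi_update_update ν i.castSucc i.succ _ _ hF]
  refine lintegral_congr fun y => ?_
  have hy : Measurable fun z : (X × X) × (Fin (K + 1) → X) × (Fin (K + 1) → X) =>
      A.swapOutcome i g (updatePair i y z.1.1 z.1.2) z.2 := by
    have h1 : Measurable fun z : (X × X) × (Fin (K + 1) → X) × (Fin (K + 1) → X) =>
        updatePair i y z.1.1 z.1.2 :=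
      measurable_updatePair i measurable_const measurable_fst.fst measurable_fst.snd
    exact A.measurable_swapOutcome i hg h1 measurable_snd
  have hy' : Measurable fun r : (Fin (K + 1) → X) × (Fin (K + 1) → X) =>
      A.swapOutcome i g (updatePair i y (r.1 0) (r.2 (Fin.last K))) r :=
    A.measurable_swapOutcome i hg
      (measurable_updatePair i measurable_const (by fun_prop) (by fun_prop)) measurable_id
  rw [← bind_prod_parallelComp, ← hκ, Measure.lintegral_bind κ.aemeasurable hy'.aemeasurable]
  refine lintegral_congr fun ab => ?_
  rw [Function.update_self, Function.update_of_ne hne, Function.update_self]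
  exact lintegral_eq_lintegral_start (G := fun z => A.swapOutcome i g
    (updatePair i y z.1.1 z.1.2) z.2) hs hstart hy ab

end APT

/-! ### Exploration of product laws and marginals of the swap. -/

theorem lintegral_pi_prod {X : Type*} [MeasurableSpace X] {ι : Type*} [Fintype ι]
    (ν : ι → Measure X) [∀ n, IsProbabilityMeasure (ν n)] {f : ι → X → ENNReal}
    (hf : ∀ n, Measurable (f n)) :
    ∫⁻ x, ∏ n, f n (x n) ∂Measure.pi ν = ∏ n, ∫⁻ a, f n a ∂ν n := by
  have hind : iIndepFun (fun n (x : ι → X) => f n (x n)) (Measure.pi ν) :=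
    iIndepFun_pi fun n => (hf n).aemeasurable
  rw [lintegral_prod_eq_prod_lintegral_of_indepFun Finset.univ _ hind
    fun n => (hf n).comp (measurable_pi_apply n)]
  exact Finset.prod_congr rfl fun n _ => (measurePreserving_eval ν n).lintegral_comp (hf n)

namespace APT

variable {X : Type*} [MeasurableSpace X] {N K : ℕ} (A : APT X N K)

theorem bind_exploration (ν : Fin (N + 1) → Measure X) [∀ n, IsProbabilityMeasure (ν n)] :
    (Measure.pi ν).bind A.exploration = Measure.pi fun n => (ν n).bind (A.explore n) := by
  refine (Measure.pi_eq fun s hs => ?_).symm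
  rw [Measure.bind_apply (MeasurableSet.univ_pi hs) A.exploration.aemeasurable]
  have h : ∀ x : Fin (N + 1) → X,
      A.exploration x (Set.univ.pi s) = ∏ n, A.explore n (x n) (s n) := fun x => by
    change Measure.pi (fun n => A.explore n (x n)) (Set.univ.pi s) = _
    rw [Measure.pi_pi]
  simp_rw [h]
  rw [lintegral_pi_prod ν fun n => (A.explore n).measurable_coe (hs n)]
  exact Finset.prod_congr rfl fun n _ =>
    (Measure.bind_apply (hs n) (A.explore n).aemeasurable).symm

theorem map_bind_fwdPath (i : Fin N) (μ : Measure X) :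
    (μ.bind (A.fwdPath i)).map (fun p => p 0) = μ := by
  rw [Measure.map_comp _ _ (by fun_prop), A.map_fwdPath, Measure.id_comp]

theorem map_bind_bwdPath (i : Fin N) (μ : Measure X) :
    (μ.bind (A.bwdPath i)).map (fun p => p (Fin.last K)) = μ := by
  rw [Measure.map_comp _ _ (by fun_prop), A.map_bwdPath, Measure.id_comp]

theorem lintegral_bind_swap (i : Fin N) (μ : Measure (Fin (N + 1) → X))
    {f : (Fin (N + 1) → X) → ENNReal} (hf : Measurable f) :
    ∫⁻ x, f x ∂(μ.bind (A.swap i)) = ∫⁻ z, f z.1 ∂(μ.bind (A.swapWithFlag i)) := by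
  rw [swap, Kernel.fst_eq, ← Measure.map_comp _ _ measurable_fst, lintegral_map hf measurable_fst]

/-! ### Detailed balance, invariance and the rejection probability. -/

section Density

/-- The density of the backward path law with respect to the forward path law. -/
def pathDensity (i : Fin N) : (Fin (K + 1) → X) → ENNReal := (A.bwdLaw i).rnDeriv (A.fwdLaw i)

theorem measurable_pathDensity (i : Fin N) : Measurable (A.pathDensity i) :=
  Measure.measurable_rnDeriv _ _

/-- The free energy terms cancel in the work difference, leaving the Metropolis ratio L(p)/L(q).
Excluding density values 0 and ⊤ makes `Real.log` and `toReal` faithful. -/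
theorem acceptProb_mul_eq_min (i : Fin N) {p q : Fin (K + 1) → X} (hp : A.pathDensity i p ≠ 0)
    (hp' : A.pathDensity i p ≠ ⊤) (hq : A.pathDensity i q ≠ 0) (hq' : A.pathDensity i q ≠ ⊤) :
    ENNReal.ofReal (A.acceptProb i p q) * A.pathDensity i q =
      min (A.pathDensity i p) (A.pathDensity i q) := by
  have ha : 0 < (A.pathDensity i p).toReal := ENNReal.toReal_pos hp hp'
  have hb : 0 < (A.pathDensity i q).toReal := ENNReal.toReal_pos hq hq'
  have hw : A.work i q - A.work i p =
      Real.log (A.pathDensity i p).toReal - Real.log (A.pathDensity i q).toReal := by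
    unfold work pathDensity; ring
  rw [← ENNReal.ofReal_toReal hp', ← ENNReal.ofReal_toReal hq', ← ENNReal.ofReal_min,
    ← ENNReal.ofReal_mul (A.acceptProb_pos i p q).le]
  congr 1
  rw [acceptProb, hw, Real.exp_monotone.map_min, Real.exp_zero, Real.exp_sub, Real.exp_log ha,
    Real.exp_log hb, min_mul_of_nonneg _ _ hb.le, one_mul, div_mul_cancel₀ _ hb.ne', min_comm]

variable [∀ n, IsProbabilityMeasure (A.annealed n)]

instance (i : Fin N) : IsProbabilityMeasure (A.fwdLaw i) := by unfold fwdLaw; infer_instance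

instance (i : Fin N) : IsProbabilityMeasure (A.bwdLaw i) := by unfold bwdLaw; infer_instance

variable {A} {i : Fin N}

theorem ae_pathDensity (hac : A.fwdLaw i ≪ A.bwdLaw i) :
    ∀ᵐ p ∂A.fwdLaw i, A.pathDensity i p ≠ 0 ∧ A.pathDensity i p ≠ ⊤ := by
  filter_upwards [Measure.rnDeriv_pos' hac, Measure.rnDeriv_lt_top (A.bwdLaw i) (A.fwdLaw i)]
    with p h1 h2 using ⟨h1.ne', h2.ne⟩

theorem ae_acceptProb_mul (hac : A.fwdLaw i ≪ A.bwdLaw i) :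
    ∀ᵐ r ∂(A.fwdLaw i).prod (A.fwdLaw i),
      ENNReal.ofReal (A.acceptProb i r.1 r.2) * A.pathDensity i r.2 =
        min (A.pathDensity i r.1) (A.pathDensity i r.2) := by
  have h := ae_pathDensity hac
  filter_upwards [Measure.quasiMeasurePreserving_fst.ae h,
    Measure.quasiMeasurePreserving_snd.ae h] with r h1 h2
  exact A.acceptProb_mul_eq_min i h1.1 h1.2 h2.1 h2.2

theorem withDensity_pathDensity (hac : A.bwdLaw i ≪ A.fwdLaw i) :
    (A.fwdLaw i).withDensity (A.pathDensity i) = A.bwdLaw i :=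
  Measure.withDensity_rnDeriv_eq _ _ hac

theorem fwdLaw_prod_bwdLaw (hac : A.bwdLaw i ≪ A.fwdLaw i) :
    (A.fwdLaw i).prod (A.bwdLaw i) =
      ((A.fwdLaw i).prod (A.fwdLaw i)).withDensity fun r => A.pathDensity i r.2 := by
  conv_lhs => rw [← withDensity_pathDensity hac]
  rw [prod_withDensity_right (A.measurable_pathDensity i)]

theorem bwdLaw_prod_fwdLaw (hac : A.bwdLaw i ≪ A.fwdLaw i) :
    (A.bwdLaw i).prod (A.fwdLaw i) =
      ((A.fwdLaw i).prod (A.fwdLaw i)).withDensity fun r => A.pathDensity i r.1 := by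
  conv_lhs => rw [← withDensity_pathDensity hac]
  rw [prod_withDensity_left (A.measurable_pathDensity i)]

theorem lintegral_fwdLaw_prod_bwdLaw (hac : A.bwdLaw i ≪ A.fwdLaw i)
    {f : (Fin (K + 1) → X) × (Fin (K + 1) → X) → ENNReal} (hf : Measurable f) :
    ∫⁻ r, f r ∂((A.fwdLaw i).prod (A.bwdLaw i)) =
      ∫⁻ r, A.pathDensity i r.2 * f r ∂((A.fwdLaw i).prod (A.fwdLaw i)) := by
  rw [fwdLaw_prod_bwdLaw hac]
  exact lintegral_withDensity_eq_lintegral_mul _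
    ((A.measurable_pathDensity i).comp measurable_snd) hf

/-- Detailed balance on path space. -/
theorem lintegral_acceptProb_swap (hac : A.fwdLaw i ≪ A.bwdLaw i ∧ A.bwdLaw i ≪ A.fwdLaw i)
    {f : (Fin (K + 1) → X) × (Fin (K + 1) → X) → ENNReal} (hf : Measurable f) :
    ∫⁻ r, ENNReal.ofReal (A.acceptProb i r.1 r.2) * f r.swap ∂((A.fwdLaw i).prod (A.bwdLaw i)) =
      ∫⁻ r, ENNReal.ofReal (A.acceptProb i r.1 r.2) * f r
        ∂((A.fwdLaw i).prod (A.bwdLaw i)) := by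
  have key : ∀ g : (Fin (K + 1) → X) × (Fin (K + 1) → X) → ENNReal, Measurable g →
      ∫⁻ r, ENNReal.ofReal (A.acceptProb i r.1 r.2) * g r ∂((A.fwdLaw i).prod (A.bwdLaw i)) =
      ∫⁻ r, min (A.pathDensity i r.1) (A.pathDensity i r.2) * g r
        ∂((A.fwdLaw i).prod (A.fwdLaw i)) := fun g hg => by
    rw [lintegral_fwdLaw_prod_bwdLaw (f := fun r => ENNReal.ofReal (A.acceptProb i r.1 r.2) * g r)
      hac.2 ((A.measurable_acceptProb i).ennreal_ofReal.mul hg)]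
    refine lintegral_congr_ae ?_
    filter_upwards [ae_acceptProb_mul hac.1] with r hr
    rw [← hr]; ring
  rw [key f hf, key (fun r => f r.swap) (hf.comp measurable_swap), ← lintegral_prod_swap]
  refine lintegral_congr fun r => ?_
  rw [Prod.fst_swap, Prod.snd_swap, min_comm, Prod.swap_swap]

/-- An accepted move inserts the starting points of the exchanged path pair, so detailed balance
turns the accepted part into one where the state is kept; together with the rejected part it sums to
the original law. -/
theorem swap_invariant (hac : A.fwdLaw i ≪ A.bwdLaw i ∧ A.bwdLaw i ≪ A.fwdLaw i) :
    (A.swap i).Invariant A.target := by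
  refine Measure.ext_of_lintegral _ fun f hf => ?_
  rw [A.lintegral_bind_swap i _ hf, target,
    A.lintegral_bind_swapWithFlag i A.annealed (g := fun z => f z.1) (hf.comp measurable_fst)]
  have hν : Function.update (Function.update A.annealed i.castSucc (A.annealed i.castSucc)) i.succ
      (A.annealed i.succ) = A.annealed := by
    rw [Function.update_eq_self, Function.update_eq_self]
  have hmarg : (A.annealed i.castSucc).prod (A.annealed i.succ) =
      ((A.fwdLaw i).prod (A.bwdLaw i)).map
        (Prod.map (fun p => p 0) (fun p => p (Fin.last K))) := by
    rw [← Measure.map_prod_map _ _ (by fun_prop) (by fun_prop), fwdLaw, bwdLaw,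
      A.map_bind_fwdPath, A.map_bind_bwdPath]
  conv_rhs => rw [← hν]
  rw [lintegral_pi_update_update _ _ _ _ _ hf]
  refine lintegral_congr fun y => ?_
  have hu : Measurable fun r : X × X => f (updatePair i y r.1 r.2) :=
    hf.comp (measurable_updatePair i measurable_const measurable_fst measurable_snd)
  have hu1 : Measurable fun r : (Fin (K + 1) → X) × (Fin (K + 1) → X) =>
      f (updatePair i y (r.1 0) (r.2 (Fin.last K))) :=
    hf.comp (measurable_updatePair i measurable_const (by fun_prop) (by fun_prop))
  have hα := (A.measurable_acceptProb i).ennreal_ofReal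
  change _ = ∫⁻ r : X × X, f (updatePair i y r.1 r.2) ∂_
  rw [hmarg, lintegral_map (f := fun r : X × X => f (updatePair i y r.1 r.2)) hu (by fun_prop)]
  simp only [swapOutcome, updatePair_updatePair, Prod.map_fst, Prod.map_snd]
  change ∫⁻ r, _ ∂((A.fwdLaw i).prod (A.bwdLaw i)) = _
  have hrej : Measurable fun r : (Fin (K + 1) → X) × (Fin (K + 1) → X) =>
      (1 - ENNReal.ofReal (A.acceptProb i r.1 r.2)) *
        f (updatePair i y (r.1 0) (r.2 (Fin.last K))) := (measurable_const.sub hα).mul hu1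
  rw [lintegral_add_right _ hrej]
  have hsymm := lintegral_acceptProb_swap hac hu1
  simp only [Prod.fst_swap, Prod.snd_swap] at hsymm
  rw [hsymm, ← lintegral_add_right _ hrej]
  refine lintegral_congr fun r => ?_
  rw [← add_mul, add_tsub_cancel_of_le, one_mul]
  exact ENNReal.ofReal_le_one.2 (A.acceptProb_le_one i _ _)

theorem exploration_invariant (hinv : ∀ n, (A.explore n).Invariant (A.annealed n)) :
    A.exploration.Invariant A.target := by
  rw [Kernel.Invariant, target, A.bind_exploration]
  congr 1
  ext1 n
  exact hinv n

theorem stepUpTo_invariant (hinv : ∀ n, (A.explore n).Invariant (A.annealed n))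
    (hac : ∀ i, A.fwdLaw i ≪ A.bwdLaw i ∧ A.bwdLaw i ≪ A.fwdLaw i) (t m : ℕ) :
    (A.stepUpTo t m).Invariant A.target := by
  induction m with
  | zero => exact exploration_invariant hinv
  | succ m ih =>
    rw [stepUpTo]
    split_ifs with h
    · exact (swap_invariant (hac _)).comp ih
    · exact ih

theorem lawAt_invariant (hinv : ∀ n, (A.explore n).Invariant (A.annealed n))
    (hac : ∀ i, A.fwdLaw i ≪ A.bwdLaw i ∧ A.bwdLaw i ≪ A.fwdLaw i) (t : ℕ) :
    (A.lawAt t).Invariant A.target := by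
  induction t with
  | zero => exact Measure.id_comp
  | succ t ih => exact (stepUpTo_invariant hinv hac _ _).comp ih

/-- Exploration and the earlier swaps of the iteration preserve the target, so the swap meets a
stationary state and the rejected mass is the mean of 1 - α under ℙ ⊗ ℚ. -/
theorem rejectionProb_eq_tvDist (hinv : ∀ n, (A.explore n).Invariant (A.annealed n))
    (hac : ∀ i, A.fwdLaw i ≪ A.bwdLaw i ∧ A.bwdLaw i ≪ A.fwdLaw i) (t : ℕ) (i : Fin N) :
    A.rejectionProb t i =
      tvDist ((A.fwdLaw i).prod (A.bwdLaw i)) ((A.bwdLaw i).prod (A.fwdLaw i)) := by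
  have hα := (A.measurable_acceptProb i).ennreal_ofReal
  have hS : MeasurableSet {z : (Fin (N + 1) → X) × Bool | z.2 = false} :=
    measurable_snd (measurableSet_singleton false)
  have h1 : A.rejectionProb t i =
      (∫⁻ r, (1 - ENNReal.ofReal (A.acceptProb i r.1 r.2))
        ∂((A.fwdLaw i).prod (A.bwdLaw i))).toReal := by
    rw [rejectionProb, stepUpTo_invariant hinv hac, measureReal_def, ← lintegral_indicator_one hS,
      target, A.lintegral_bind_swapWithFlag i _ (measurable_one.indicator hS)]
    simp only [swapOutcome, Set.indicator, Set.mem_ofPred_eq, Bool.true_eq_false, if_false, if_true,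
      mul_zero, zero_add, Pi.one_apply, mul_one, lintegral_const, measure_univ]
    rfl
  have e1 := fwdLaw_prod_bwdLaw (hac i).2
  have e2 := bwdLaw_prod_fwdLaw (hac i).2
  have p1 : IsProbabilityMeasure (((A.fwdLaw i).prod (A.fwdLaw i)).withDensity
      fun r => A.pathDensity i r.2) := by rw [← e1]; infer_instance
  have p2 : IsProbabilityMeasure (((A.fwdLaw i).prod (A.fwdLaw i)).withDensity
      fun r => A.pathDensity i r.1) := by rw [← e2]; infer_instance
  rw [h1, lintegral_fwdLaw_prod_bwdLaw (f := fun r => 1 - ENNReal.ofReal (A.acceptProb i r.1 r.2))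
    (hac i).2 (measurable_const.sub hα), e1, e2,
    tvDist_withDensity (ξ := (A.fwdLaw i).prod (A.fwdLaw i))
      (u := fun r => A.pathDensity i r.2) (v := fun r => A.pathDensity i r.1)
      ((A.measurable_pathDensity i).comp measurable_snd)
      ((A.measurable_pathDensity i).comp measurable_fst) (by rw [measure_univ, measure_univ])]
  congr 1
  refine lintegral_congr_ae ?_
  filter_upwards [ae_acceptProb_mul (hac i).1,
    Measure.quasiMeasurePreserving_snd.ae (ae_pathDensity (hac i).1)] with r hr hr2
  -- L(q)(1 - α) = L(q) - min(L(p), L(q)), which is the truncated difference L(q) - L(p).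
  rw [ENNReal.mul_sub fun _ _ => hr2.2, mul_one, mul_comm, hr, min_comm, tsub_min]

end Density

end APT

/-! ### The law from every initial state eventually dominates the target. -/

theorem countablyGenerated_pi {X : Type*} [MeasurableSpace X]
    [h : MeasurableSpace.CountablyGenerated X] {ι : Type*} [Countable ι] :
    MeasurableSpace.CountablyGenerated (ι → X) := by
  obtain ⟨b, hb, hX⟩ := h.isCountablyGenerated
  refine ⟨⋃ i : ι, Set.preimage (fun x : ι → X => x i) '' b,
    Set.countable_iUnion fun i => hb.image _, ?_⟩
  rw [← MeasurableSpace.iSup_generateFrom]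
  simp_rw [← MeasurableSpace.comap_generateFrom, ← hX]
  rfl

theorem pi_dirac {X : Type*} [MeasurableSpace X] {ι : Type*} [Fintype ι] (x : ι → X) :
    Measure.pi (fun n => Measure.dirac (x n)) = Measure.dirac x := by
  refine Measure.pi_eq fun s hs => ?_
  rw [Measure.dirac_apply' _ (MeasurableSet.univ_pi hs)]
  simp_rw [Measure.dirac_apply' _ (hs _)]
  by_cases h : x ∈ Set.univ.pi s
  · rw [Set.indicator_of_mem h, Pi.one_apply, Finset.prod_eq_one]
    intro n _
    rw [Set.indicator_of_mem (h n (Set.mem_univ n)), Pi.one_apply]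
  · rw [Set.indicator_of_notMem h]
    simp only [Set.mem_pi, Set.mem_univ, true_imp_iff, not_forall] at h
    obtain ⟨n, hn⟩ := h
    exact (Finset.prod_eq_zero (Finset.mem_univ n) (Set.indicator_of_notMem hn _)).symm

namespace APT

variable {X : Type*} [MeasurableSpace X] {N K : ℕ} (A : APT X N K)

/-- Since every swap is accepted with positive probability, the law after a swap dominates the
law in which the coordinates `i` and `i + 1` are replaced by the end points of the paths. -/
theorem pi_update_absolutelyContinuous_bind_swap (i : Fin N) (ν : Fin (N + 1) → Measure X)
    [∀ n, IsProbabilityMeasure (ν n)] {μ₁ μ₂ : Measure X} [IsProbabilityMeasure μ₁]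
    [IsProbabilityMeasure μ₂]
    (h₁ : μ₁ ≪ ((ν i.succ).bind (A.bwdPath i)).map (fun q => q 0))
    (h₂ : μ₂ ≪ ((ν i.castSucc).bind (A.fwdPath i)).map (fun p => p (Fin.last K))) :
    Measure.pi (Function.update (Function.update ν i.castSucc μ₁) i.succ μ₂) ≪
      (Measure.pi ν).bind (A.swap i) := by
  refine Measure.AbsolutelyContinuous.mk fun B hB h0 => ?_
  have hind : Measurable (B.indicator (1 : (Fin (N + 1) → X) → ENNReal)) :=
    measurable_one.indicator hB
  have hg : Measurable fun z : (Fin (N + 1) → X) × Bool =>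
      B.indicator (1 : (Fin (N + 1) → X) → ENNReal) z.1 := hind.comp measurable_fst
  rw [← lintegral_indicator_one hB, A.lintegral_bind_swap i _ hind,
    A.lintegral_bind_swapWithFlag i ν hg, lintegral_eq_zero_iff] at h0
  swap
  · have hm : Measurable fun z : (Fin (N + 1) → X) × (Fin (K + 1) → X) × (Fin (K + 1) → X) =>
        A.swapOutcome i (fun z => B.indicator 1 z.1)
          (updatePair i z.1 (z.2.1 0) (z.2.2 (Fin.last K))) z.2 :=
      A.measurable_swapOutcome i hg
        (measurable_updatePair i measurable_fst (by fun_prop) (by fun_prop)) measurable_snd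
    exact hm.lintegral_prod_right'
  rw [← lintegral_indicator_one hB, lintegral_pi_update_update _ _ _ _ _ hind,
    lintegral_eq_zero_iff (Measurable.lintegral_prod_right (f := fun y (r : X × X) => B.indicator 1
      (Function.update (Function.update y i.castSucc r.1) i.succ r.2))
      (hind.comp (measurable_update_update _ _)))]
  filter_upwards [h0] with y hy
  rw [Pi.zero_apply, lintegral_eq_zero_iff] at hy
  swap
  · exact A.measurable_swapOutcome i hg
      (measurable_updatePair i measurable_const (by fun_prop) (by fun_prop)) measurable_id
  have hm : Measurable fun r : X × X => B.indicator (1 : (Fin (N + 1) → X) → ENNReal)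
      (updatePair i y r.1 r.2) :=
    hind.comp (measurable_updatePair i measurable_const measurable_fst measurable_snd)
  change ∫⁻ r : X × X, B.indicator 1 (updatePair i y r.1 r.2) ∂(μ₁.prod μ₂) = 0
  rw [lintegral_eq_zero_iff hm]
  refine (h₁.prod h₂).ae_le ?_
  -- The lower coordinate receives the end of the backward path, hence the exchange of factors.
  rw [Measure.map_prod_map _ _ (by fun_prop) (by fun_prop), ← Measure.prod_swap,
    Measure.map_map (by fun_prop) measurable_swap]
  refine (ae_map_iff (by fun_prop) (measurableSet_eq_fun hm measurable_const)).2 ?_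
  filter_upwards [hy] with r hr
  simp only [swapOutcome, updatePair_updatePair, Pi.zero_apply, add_eq_zero, mul_eq_zero] at hr
  exact hr.1.resolve_left (ENNReal.ofReal_pos.2 (A.acceptProb_pos i _ _)).ne'

/-- `μ` dominates a product distribution whose coordinates in `G` are the annealing
distributions. -/
def Dominates (μ : Measure (Fin (N + 1) → X)) (G : ℕ → Prop) : Prop :=
  ∃ ν : Fin (N + 1) → Measure X, (∀ n, IsProbabilityMeasure (ν n)) ∧
    (∀ n : Fin (N + 1), G n → ν n = A.annealed n) ∧ Measure.pi ν ≪ μ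

variable {A} {μ : Measure (Fin (N + 1) → X)} {G G' : ℕ → Prop}

theorem Dominates.mono (h : A.Dominates μ G) (hG : ∀ n ≤ N, G' n → G n) : A.Dominates μ G' := by
  obtain ⟨ν, h1, h2, h3⟩ := h
  exact ⟨ν, h1, fun n hn => h2 n (hG n (Nat.lt_succ_iff.1 n.2) hn), h3⟩

/-- The kernel at coordinate 0 forgets the state and produces π^0 from anything; invariance keeps
the other refreshed coordinates. -/
theorem Dominates.exploration (h : A.Dominates μ G)
    (hinv : ∀ n, (A.explore n).Invariant (A.annealed n))
    (href : A.explore 0 = Kernel.const X (A.annealed 0)) :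
    A.Dominates (μ.bind A.exploration) fun n => n = 0 ∨ G n := by
  obtain ⟨ν, h1, h2, h3⟩ := h
  refine ⟨fun n => (ν n).bind (A.explore n), fun n => inferInstance, ?_, ?_⟩
  · rintro n (hn | hn)
    · obtain rfl : n = 0 := Fin.ext hn
      simp only [href]
      rw [Measure.const_comp, measure_univ, one_smul]
    · simp only [h2 n hn]
      exact hinv n
  · rw [← A.bind_exploration]
    exact h3.comp_right _

/-- A forward path started at π^{n-1} ends with the last marginal of ℙ, which dominates that of ℚ,
namely π^n; backward paths are symmetric. An unrefreshed coordinate just passes on the end point law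
of its path. -/
theorem Dominates.swap [∀ n, IsProbabilityMeasure (A.annealed n)] (h : A.Dominates μ G)
    (i : Fin N) (hac : A.fwdLaw i ≪ A.bwdLaw i ∧ A.bwdLaw i ≪ A.fwdLaw i)
    (hi : G' (i : ℕ) → G ((i : ℕ) + 1)) (hi' : G' ((i : ℕ) + 1) → G (i : ℕ))
    (hG : ∀ n : ℕ, n ≠ i → n ≠ (i : ℕ) + 1 → G' n → G n) : A.Dominates (μ.bind (A.swap i)) G' := by
  obtain ⟨ν, h1, h2, h3⟩ := h
  obtain ⟨μ₁, p₁, ac₁, e₁⟩ : ∃ μ₁ : Measure X, IsProbabilityMeasure μ₁ ∧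
      μ₁ ≪ ((ν i.succ).bind (A.bwdPath i)).map (fun q => q 0) ∧
      (G ((i : ℕ) + 1) → μ₁ = A.annealed i.castSucc) := by
    by_cases hg : G ((i : ℕ) + 1)
    · refine ⟨A.annealed i.castSucc, inferInstance, ?_, fun _ => rfl⟩
      rw [h2 i.succ (by simpa using hg), ← A.map_bind_fwdPath i (A.annealed i.castSucc)]
      exact hac.1.map (by fun_prop)
    · exact ⟨_, Measure.isProbabilityMeasure_map (measurable_pi_apply _).aemeasurable,
        Measure.AbsolutelyContinuous.rfl, fun h => absurd h hg⟩
  obtain ⟨μ₂, p₂, ac₂, e₂⟩ : ∃ μ₂ : Measure X, IsProbabilityMeasure μ₂ ∧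
      μ₂ ≪ ((ν i.castSucc).bind (A.fwdPath i)).map (fun p => p (Fin.last K)) ∧
      (G (i : ℕ) → μ₂ = A.annealed i.succ) := by
    by_cases hg : G (i : ℕ)
    · refine ⟨A.annealed i.succ, inferInstance, ?_, fun _ => rfl⟩
      rw [h2 i.castSucc (by simpa using hg), ← A.map_bind_bwdPath i (A.annealed i.succ)]
      exact hac.2.map (by fun_prop)
    · exact ⟨_, Measure.isProbabilityMeasure_map (measurable_pi_apply _).aemeasurable,
        Measure.AbsolutelyContinuous.rfl, fun h => absurd h hg⟩
  refine ⟨Function.update (Function.update ν i.castSucc μ₁) i.succ μ₂, inferInstance, ?_,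
    (A.pi_update_absolutelyContinuous_bind_swap i ν ac₁ ac₂).trans (h3.comp_right _)⟩
  intro n hn
  by_cases hn1 : n = i.succ
  · subst hn1
    rw [Function.update_self]
    exact e₂ (hi' (by simpa using hn))
  rw [Function.update_of_ne hn1]
  by_cases hn0 : n = i.castSucc
  · subst hn0
    rw [Function.update_self]
    exact e₁ (hi (by simpa using hn))
  rw [Function.update_of_ne hn0]
  refine h2 n (hG n (fun h => hn0 (Fin.ext (by simpa using h)))
    (fun h => hn1 (Fin.ext (by simpa using h))) hn)

/-- If all swaps of iteration `t` with number at most `m` are accepted, the coordinates in `G` and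
the coordinate `0` are moved to this set. -/
def movedSet (G : ℕ → Prop) (t m n : ℕ) : Prop :=
  (n % 2 = t % 2 ∧ 1 ≤ n ∧ n ≤ m → n = 1 ∨ G (n - 1)) ∧
    ((n + 1) % 2 = t % 2 ∧ n + 1 ≤ m → G (n + 1)) ∧
    (¬(n % 2 = t % 2 ∧ 1 ≤ n ∧ n ≤ m) → ¬((n + 1) % 2 = t % 2 ∧ n + 1 ≤ m) → n = 0 ∨ G n)

/-- Swaps of one parity act on disjoint pairs, so the next swap finds both its coordinates as
exploration left them. -/
theorem Dominates.stepUpTo [∀ n, IsProbabilityMeasure (A.annealed n)] (h : A.Dominates μ G)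
    (hinv : ∀ n, (A.explore n).Invariant (A.annealed n))
    (href : A.explore 0 = Kernel.const X (A.annealed 0))
    (hac : ∀ i, A.fwdLaw i ≪ A.bwdLaw i ∧ A.bwdLaw i ≪ A.fwdLaw i) (t m : ℕ) (hm : m ≤ N) :
    A.Dominates (μ.bind (A.stepUpTo t m)) (movedSet G t m) := by
  induction m with
  | zero =>
    refine (h.exploration hinv href).mono fun n _ hn => hn.2.2 (by omega) (by omega)
  | succ m ih =>
    rw [APT.stepUpTo]
    split_ifs with hs
    · have hs2 : (m + 1) % 2 = t % 2 := hs.2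
      rw [← Measure.comp_assoc]
      refine (ih (by omega)).swap ⟨m, hs.1⟩ (hac _) ?_ ?_ ?_
      · rintro ⟨-, h2, -⟩
        refine ⟨by simp only; omega, by simp only; omega, fun _ _ => Or.inr ?_⟩
        exact h2 ⟨hs2, le_rfl⟩
      · rintro ⟨h1, -, -⟩
        have h1 := h1 ⟨hs2, by simp, le_rfl⟩
        refine ⟨by simp only; omega, by simp only; omega, fun _ _ => ?_⟩
        simpa using h1
      · rintro n hn hn' ⟨h1, h2, h3⟩
        simp only at hn hn'
        exact ⟨fun h => h1 ⟨h.1, h.2.1, by omega⟩, fun h => h2 ⟨h.1, by omega⟩,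
          fun h h' => h3 (by omega) (by omega)⟩
    · refine (ih (by omega)).mono fun n hn ⟨h1, h2, h3⟩ => ?_
      have hs2 : ¬ (m + 1) % 2 = t % 2 := fun h => hs ⟨by omega, h⟩
      exact ⟨fun h => h1 ⟨h.1, h.2.1, by omega⟩, fun h => h2 ⟨h.1, by omega⟩,
        fun h h' => h3 (fun h4 => h ⟨h4.1, h4.2.1, by
          rcases Nat.lt_or_ge m n with h5 | h5
          · exact absurd ((show m + 1 = n by omega) ▸ h4.1) hs2
          · exact h5⟩) (fun h4 => h' ⟨h4.1, by
          rcases Nat.lt_or_ge m (n + 1) with h5 | h5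
          · exact absurd ((show m + 1 = n + 1 by omega) ▸ h4.1) hs2
          · exact h5⟩)⟩

/-- The coordinates whose lineage has visited the coordinate `0` by time `t`, when all swaps are
accepted. -/
def refreshed (N t n : ℕ) : Prop :=
  (n % 2 = t % 2 ∧ n ≤ t ∧ 0 < t) ∨ (n % 2 ≠ t % 2 ∧ 2 * N + 1 ≤ n + t)

/-- After iteration t, a lineage on a coordinate n ≡ t climbs by one per iteration, so it left 0 if
n ≤ t. One with n ≢ t descends: it reached N, waited there for one iteration and turned, so n + t ≥
2N + 1. At time 0 nothing is refreshed yet. -/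
theorem dominates_lawAt [∀ n, IsProbabilityMeasure (A.annealed n)]
    (hinv : ∀ n, (A.explore n).Invariant (A.annealed n))
    (href : A.explore 0 = Kernel.const X (A.annealed 0))
    (hac : ∀ i, A.fwdLaw i ≪ A.bwdLaw i ∧ A.bwdLaw i ≪ A.fwdLaw i) (t : ℕ)
    (x : Fin (N + 1) → X) : A.Dominates (A.lawAt t x) (refreshed N t) := by
  induction t with
  | zero =>
    refine ⟨fun n => Measure.dirac (x n), fun n => inferInstance, fun n hn => ?_, ?_⟩
    · have := n.2
      unfold refreshed at hn
      omega
    · rw [pi_dirac, lawAt, Kernel.id_apply]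
  | succ t ih =>
    rw [lawAt, Kernel.comp_apply]
    refine (ih.stepUpTo hinv href hac (t + 1) N le_rfl).mono fun n hn h => ?_
    unfold refreshed at h
    unfold movedSet refreshed
    omega

theorem target_absolutelyContinuous_lawAt [∀ n, IsProbabilityMeasure (A.annealed n)]
    (hinv : ∀ n, (A.explore n).Invariant (A.annealed n))
    (href : A.explore 0 = Kernel.const X (A.annealed 0))
    (hac : ∀ i, A.fwdLaw i ≪ A.bwdLaw i ∧ A.bwdLaw i ≪ A.fwdLaw i) (x : Fin (N + 1) → X) :
    A.target ≪ A.lawAt (2 * (N + 1)) x := by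
  obtain ⟨ν, -, h2, h3⟩ := dominates_lawAt hinv href hac (2 * (N + 1)) x
  -- Time 2N + 1 already refreshes all coordinates; 2(N + 1) is the next multiple of the period 2 of
  -- the schedule.
  have : ν = A.annealed := funext fun n => h2 n (by
    have := n.2
    unfold refreshed
    omega)
  rwa [this] at h3

/-! ### Periodicity of the schedule and convergence. -/

variable (A)

theorem stepUpTo_add_two_mul (t s m : ℕ) : A.stepUpTo (t + 2 * s) m = A.stepUpTo t m := by
  induction m with
  | zero => rfl
  | succ m ih =>
    have h : m + 1 ≡ t + 2 * s [MOD 2] ↔ m + 1 ≡ t [MOD 2] := by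
      unfold Nat.ModEq; omega
    simp only [stepUpTo, ih, h]

theorem lawAt_add_two_mul (t s : ℕ) : A.lawAt (t + 2 * s) = A.lawAt t ∘ₖ A.lawAt (2 * s) := by
  induction t with
  | zero => rw [zero_add, lawAt, Kernel.id_comp]
  | succ t ih =>
    rw [show t + 1 + 2 * s = (t + 2 * s) + 1 by ring, lawAt, lawAt, ih, Kernel.comp_assoc, step,
      step, show t + 2 * s + 1 = t + 1 + 2 * s by ring, stepUpTo_add_two_mul]

theorem ae_tendsto_tvDist_lawAt [MeasurableSpace.CountablyGenerated X]
    [∀ n, IsProbabilityMeasure (A.annealed n)]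
    (hinv : ∀ n, (A.explore n).Invariant (A.annealed n))
    (href : A.explore 0 = Kernel.const X (A.annealed 0))
    (hac : ∀ i, A.fwdLaw i ≪ A.bwdLaw i ∧ A.bwdLaw i ≪ A.fwdLaw i) :
    ∀ᵐ x ∂A.target,
      Filter.Tendsto (fun t => tvDist (A.lawAt t x) A.target) Filter.atTop (nhds 0) := by
  have hcg : MeasurableSpace.CountablyGenerated (Fin (N + 1) → X) := countablyGenerated_pi
  have hprob : IsProbabilityMeasure A.target := by unfold target; infer_instance
  have key := ae_tendsto_tvDist_of_invariant (κ := fun q => A.lawAt (2 * ((N + 1) * q)))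
    (π := A.target) (fun s t => by rw [← lawAt_add_two_mul]; congr 1; ring)
    (fun t => lawAt_invariant hinv hac _)
    (fun x => by rw [mul_one]; exact target_absolutelyContinuous_lawAt hinv href hac x)
  filter_upwards [key] with x hx
  have hanti : Antitone fun t => tvDist (A.lawAt t x) A.target :=
    antitone_nat_of_succ_le fun t => by
      have h := tvDist_bind_le (A.lawAt t x) A.target (A.step (t + 1))
      rwa [step, stepUpTo_invariant hinv hac, ← step, ← Kernel.comp_apply] at h
  -- Each step contracts the distance to the invariant target, so convergence along block times is
  -- enough.
  refine (tendsto_iff_tendsto_subseq_of_antitone hanti ?_).2 hx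
  exact Filter.tendsto_atTop_mono
    (fun q => by simp only [id]; nlinarith [Nat.zero_le (N * q)]) Filter.tendsto_id

end APT

end

theorem theorem1 {X : Type*} [MeasurableSpace X] [MeasurableSpace.CountablyGenerated X]
    {N K : ℕ} (A : APT X N K)
    (hbase : A.base ≠ 0)
    (hU : ∀ n, Measurable (A.U n))
    (hZ : ∀ n, Integrable (fun x => Real.exp (-A.U n x)) A.base)
    (hinv : ∀ n, (A.explore n).Invariant (A.annealed n))
    (href : A.explore 0 = Kernel.const X (A.annealed 0))
    (hac : ∀ i, A.fwdLaw i ≪ A.bwdLaw i ∧ A.bwdLaw i ≪ A.fwdLaw i) :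
    (∀ᵐ x ∂A.target,
        Filter.Tendsto (fun t => tvDist (A.lawAt t x) A.target) Filter.atTop (nhds 0)) ∧
      (∀ t, 1 ≤ t → (A.step t).Invariant A.target) ∧
      (∀ (t : ℕ) (i : Fin N), 1 ≤ t → (i : ℕ) + 1 ≡ t [MOD 2] →
        A.rejectionProb t i =
          tvDist ((A.fwdLaw i).prod (A.bwdLaw i)) ((A.bwdLaw i).prod (A.fwdLaw i))) := by
  have : NeZero A.base := ⟨hbase⟩
  have hprob : ∀ n, IsProbabilityMeasure (A.annealed n) := fun n =>
    isProbabilityMeasure_tilted (hZ n)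
  exact ⟨A.ae_tendsto_tvDist_lawAt hinv href hac,
    fun t _ => APT.stepUpTo_invariant hinv hac t N,
    fun t i _ _ => APT.rejectionProb_eq_tvDist hinv hac t i⟩
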